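/- **Setting.** Literals are propositional variables $x$ or their negations $\bar x$; a clause is a finite set of literals and a CNF a finite set of clauses. An S-form DQBF $\forall U\,\exists E\,\psi$ has finite disjoint sets $U$, $E$ of universal and existential variables, a dependency set $D_x\subseteq U$ for each $x\in E$, and a CNF $\psi$ all of whose variables lie in $U\cup E$; put $D_w=\{w\}$ for $w\in U$. Its size is its number of symbols. Fix any Frege system: a finite, sound and implicationally complete set of schematic rules for formulas over $0,1,\neg,\wedge,\vee,\to,\leftrightarrow$. The proof system dFrege$+\forall$red derives lines (formulas over the currently quantified variables) from $\forall U\,\exists E\,\psi$ by these rules: - Axiom: any clause of $\psi$; - any instance of a rule of the Frege system; - Independent extension: the line $\alpha\to(v\leftrightarrow\bigwedge_{y\in Y}y)$ or $\alpha\to(v\leftrightarrow\bigvee_{y\in Y}y)$, where $\alpha$ is a conjunction of universal literals, $Y$ is a finite set of literals and $v$ is a fresh existential variable, which gets $D_v=\bigl(\bigcup_{y\in Y}D_{\mathrm{var}(y)}\bigr)\setminus\mathrm{var}(\alpha)$; - Reduction: from $L(w)$ derive $L(0)$ or $L(1)$, if $w$ is universal and no existential variable $x$ of $L$ has $w\in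 D_x$; - addition of a fresh universal or existential variable to the quantifiers. For a CNF $\theta$, $\theta\vdash_1\bot$ means that unit propagation on $\theta$ produces the empty clause. For a literal $u$ of a universal variable let $\mathcal S=\{x\in E: \mathrm{var}(u)\in D_x\}$ and $T=\{w\in U: w\ne\mathrm{var}(u),\ w\in D_x\text{ for all }x\in\mathcal S\}$. The outer clause $O_D$ of a clause $D$ consists of the existential literals $k\in D$ with $D_{\mathrm{var}(k)}\subseteq T$ and the universal literals $k\in D$ with $\mathrm{var}(k)\in T$. For a CNF $\psi$ and a clause $K_0\in\psi$, the path literals from $K_0$ form the least set that contains all literals of $K_0$ with variable in $\mathcal S$ and, whenever it contains $p$ and $\bar p\in D\in\psi$, also contains all $q\in D$ with $q\neq\bar p$ and variable in $\mathcal S$. The clauses reachable from $K_0$ are $K_0$ and all $D\in\psi$ with $\bar p\in D$ for some path literal $p$. **Lemma (mixed QRATU/EUR reduction for DQBF).** For every Frege system there is a polynomial $P$ such that the following holds. Let $\forall U\,\exists E\,\psi$ be an S-form DQBF with $\psi=\phi\wedge(C\vee u)$, where $u$ is a literal of a universal variable, and let $\chi_0$ be the set of clauses of $\psi$ reachable from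 $C\vee u$. Suppose that every $D\in\chi_0$ with $\bar u\in D$ satisfies $\phi\wedge\bar C\wedge\bar O_D\vdash_1\bot$. Then with at most $P(\mathrm{size}(\forall U\,\exists E\,\psi))$ rule applications of dFrege$+\forall$red one can extend $\exists E$ to some $\exists E'$ (with $U$ and the dependency sets of the variables in $E$ unchanged) containing for each $x\in\mathcal S$ a new variable $x'$ with $D_{x'}\subseteq D_x$, these variables being pairwise distinct, and derive every clause of $(\phi\wedge C)'$, the copy of $\phi\wedge C$ in which every $x\in\mathcal S$ is replaced by $x'$. -/

import Mathlib

namespace DFrege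

/-! ### Propositional syntax -/

/-- Literals over the countably infinite set `ℕ` of propositional variables. -/
structure Literal where
  var : ℕ
  pos : Bool
deriving DecidableEq

/-- The complementary literal. -/
def Literal.neg (l : Literal) : Literal := ⟨l.var, !l.pos⟩

/-- A clause is a finite set of literals. -/
abbrev Clause := Finset Literal

/-- A formula in conjunctive normal form, as its finite set of clauses. -/
abbrev CNF := Finset Clause

/-- Propositional formulas. -/
inductive Formula where
  | fls : Formula
  | tru : Formula
  | var : ℕ → Formula
  | neg : Formula → Formula
  | and : Formula → Formula → Formula
  | or : Formula → Formula → Formula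
  | imp : Formula → Formula → Formula
  | iff : Formula → Formula → Formula

namespace Formula

/-- The set of variables of a formula. -/
def vars : Formula → Finset ℕ
  | fls => ∅
  | tru => ∅
  | var x => {x}
  | neg a => a.vars
  | and a b => a.vars ∪ b.vars
  | or a b => a.vars ∪ b.vars
  | imp a b => a.vars ∪ b.vars
  | iff a b => a.vars ∪ b.vars

/-- Truth of a formula under a valuation. -/
def Holds (v : ℕ → Prop) : Formula → Prop
  | fls => False
  | tru => True
  | var x => v x
  | neg a => ¬ a.Holds v
  | and a b => a.Holds v ∧ b.Holds v
  | or a b => a.Holds v ∨ b.Holds v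
  | imp a b => a.Holds v → b.Holds v
  | iff a b => (a.Holds v ↔ b.Holds v)

/-- Simultaneous substitution of formulas for variables. -/
def subst (σ : ℕ → Formula) : Formula → Formula
  | fls => fls
  | tru => tru
  | var x => σ x
  | neg a => neg (a.subst σ)
  | and a b => and (a.subst σ) (b.subst σ)
  | or a b => or (a.subst σ) (b.subst σ)
  | imp a b => imp (a.subst σ) (b.subst σ)
  | iff a b => iff (a.subst σ) (b.subst σ)

/-- `L.replace u b` is `L(b)`: every occurrence of the variable `u` in `L` becomes `b`. -/
def replace (L : Formula) (u : ℕ) (b : Formula) : Formula :=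
  L.subst (Function.update var u b)

/-- Finite conjunction; the empty one is `1`. -/
def bigAnd (l : List Formula) : Formula := l.foldr and tru

/-- Finite disjunction; the empty one is `0`. -/
def bigOr (l : List Formula) : Formula := l.foldr or fls

end Formula

/-- A literal as a formula. -/
def Literal.toFormula (l : Literal) : Formula :=
  if l.pos then Formula.var l.var else Formula.neg (Formula.var l.var)

/-- A clause as a formula: the disjunction of its literals, listed in some fixed order. -/
noncomputable def clauseFormula (C : Clause) : Formula :=
  Formula.bigOr (C.toList.map Literal.toFormula)

/-! ### Frege systems -/

/-- A schematic inference rule; an axiom scheme is a rule without premises. -/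
structure FregeRule where
  premises : List Formula
  conclusion : Formula

/-- Derivability from the hypotheses `Γ` by substitution instances of the rules. -/
inductive FregeDerivable (rules : List FregeRule) (Γ : List Formula) : Formula → Prop
  | hyp {A : Formula} : A ∈ Γ → FregeDerivable rules Γ A
  | rule {r : FregeRule} (σ : ℕ → Formula) : r ∈ rules →
      (∀ A ∈ r.premises, FregeDerivable rules Γ (A.subst σ)) →
      FregeDerivable rules Γ (r.conclusion.subst σ)

/-- A Frege system: a finite list of schematic rules that is sound and
(implicationally) complete. -/
structure FregeSystem where
  rules : List FregeRule
  sound : ∀ r ∈ rules, ∀ v : ℕ → Prop,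
    (∀ A ∈ r.premises, A.Holds v) → r.conclusion.Holds v
  complete : ∀ (Γ : List Formula) (B : Formula),
    (∀ v : ℕ → Prop, (∀ A ∈ Γ, A.Holds v) → B.Holds v) → FregeDerivable rules Γ B

/-! ### S-form DQBFs -/

/-- The quantifiers of an S-form DQBF: the universal variables, the existential variables
and their dependency sets (`dep x` is relevant only for existential `x`). -/
structure DepPrefix where
  univ : Finset ℕ
  exis : Finset ℕ
  dep : ℕ → Finset ℕ
  disjoint : Disjoint univ exis
  dep_subset : ∀ x ∈ exis, dep x ⊆ univ

namespace DepPrefix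

/-- All quantified variables. -/
def vars (P : DepPrefix) : Finset ℕ := P.univ ∪ P.exis

/-- The dependency set of a quantified variable, where `D_u = {u}` for universal `u`. -/
def depSet (P : DepPrefix) (x : ℕ) : Finset ℕ := if x ∈ P.exis then P.dep x else {x}

/-- Add the new existential variable `v` with dependency set `D`. -/
def addExists (P : DepPrefix) (v : ℕ) (D : Finset ℕ) (hv : v ∉ P.vars) (hD : D ⊆ P.univ) :
    DepPrefix where
  univ := P.univ
  exis := insert v P.exis
  dep := Function.update P.dep v D
  disjoint := by
    rw [Finset.disjoint_insert_right]
    exact ⟨fun h => hv (Finset.mem_union_left _ h), P.disjoint⟩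
  dep_subset := by
    intro x hx
    by_cases h : x = v
    · subst h
      simpa using hD
    · simpa [Function.update_of_ne h] using P.dep_subset x (Finset.mem_of_mem_insert_of_ne hx h)

/-- Add the new universal variable `v`. -/
def addForall (P : DepPrefix) (v : ℕ) (hv : v ∉ P.vars) : DepPrefix where
  univ := insert v P.univ
  exis := P.exis
  dep := P.dep
  disjoint := by
    rw [Finset.disjoint_insert_left]
    exact ⟨fun h => hv (Finset.mem_union_right _ h), P.disjoint⟩
  dep_subset := fun x hx => (P.dep_subset x hx).trans (Finset.subset_insert _ _)

/-- The dependency set `(⋃_{y ∈ Y} D_y) \ D_α` of an independent extension variable. -/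
def extDep (P : DepPrefix) (α Y : Finset Literal) : Finset ℕ :=
  (Y.biUnion fun y => P.depSet y.var) \ α.image Literal.var

theorem extDep_subset (P : DepPrefix) (α Y : Finset Literal)
    (hY : ∀ y ∈ Y, y.var ∈ P.vars) : P.extDep α Y ⊆ P.univ := by
  refine Finset.sdiff_subset.trans (Finset.biUnion_subset.2 fun y hy => ?_)
  unfold depSet
  split_ifs with h
  · exact P.dep_subset _ h
  · rcases Finset.mem_union.1 (hY y hy) with h' | h'
    · simpa using h'
    · exact absurd h' h

end DepPrefix

/-- A closed S-form DQBF with a CNF matrix. -/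
structure DQBF where
  pre : DepPrefix
  matrix : CNF
  closed : ∀ K ∈ matrix, ∀ l ∈ K, l.var ∈ pre.vars

/-- The size of a DQBF: the number of symbols, counting every variable, every element of a
dependency set, every clause and every occurrence of a literal. -/
def DQBF.size (Q : DQBF) : ℕ :=
  Q.pre.univ.card + ∑ x ∈ Q.pre.exis, (1 + (Q.pre.dep x).card) +
    ∑ K ∈ Q.matrix, (1 + K.card)

/-! ### The proof system dFrege+∀red -/

/-- A stage of a derivation: the current quantifiers and the lines derived so far. -/
structure Stage where
  pre : DepPrefix
  lines : List Formula

/-- The conjunction of a finite set of literals, as a formula. -/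
noncomputable def conjFormula (Y : Finset Literal) : Formula :=
  Formula.bigAnd (Y.toList.map Literal.toFormula)

/-- One rule application of dFrege+∀red, over the Frege system `F` and a matrix with the
set of conjuncts `M`. All lines contain only quantified variables. -/
inductive Step (F : FregeSystem) (M : Set Formula) : Stage → Stage → Prop
  /-- Axiom: a conjunct of the matrix. -/
  | ax (P : DepPrefix) (Γ : List Formula) (L : Formula) :
      L ∈ M → Step F M ⟨P, Γ⟩ ⟨P, L :: Γ⟩
  /-- A substitution instance of a rule of the Frege system. -/
  | frege (P : DepPrefix) (Γ : List Formula) (r : FregeRule) (σ : ℕ → Formula) :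
      r ∈ F.rules → (∀ A ∈ r.premises, A.subst σ ∈ Γ) →
      (r.conclusion.subst σ).vars ⊆ P.vars →
      Step F M ⟨P, Γ⟩ ⟨P, r.conclusion.subst σ :: Γ⟩
  /-- IndExt-∧: the line `α → (v ↔ ⋀ Y)` for a fresh existential variable `v`. -/
  | indExtAnd (P : DepPrefix) (Γ : List Formula) (α Y : Finset Literal) (v : ℕ)
      (hα : ∀ a ∈ α, a.var ∈ P.univ) (hY : ∀ y ∈ Y, y.var ∈ P.vars) (hv : v ∉ P.vars) :
      Step F M ⟨P, Γ⟩
        ⟨P.addExists v (P.extDep α Y) hv (P.extDep_subset α Y hY),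
          Formula.imp (conjFormula α) (Formula.iff (Formula.var v) (conjFormula Y)) :: Γ⟩
  /-- IndExt-∨: the line `α → (v ↔ ⋁ Y)` for a fresh existential variable `v`. -/
  | indExtOr (P : DepPrefix) (Γ : List Formula) (α Y : Finset Literal) (v : ℕ)
      (hα : ∀ a ∈ α, a.var ∈ P.univ) (hY : ∀ y ∈ Y, y.var ∈ P.vars) (hv : v ∉ P.vars) :
      Step F M ⟨P, Γ⟩
        ⟨P.addExists v (P.extDep α Y) hv (P.extDep_subset α Y hY),
          Formula.imp (conjFormula α) (Formula.iff (Formula.var v) (clauseFormula Y)) :: Γ⟩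
  /-- 0-red: from `L(u)` derive `L(0)`. -/
  | red0 (P : DepPrefix) (Γ : List Formula) (L : Formula) (u : ℕ) :
      L ∈ Γ → u ∈ P.univ → (∀ x ∈ L.vars, x ∈ P.exis → u ∉ P.dep x) →
      Step F M ⟨P, Γ⟩ ⟨P, L.replace u Formula.fls :: Γ⟩
  /-- 1-red: from `L(u)` derive `L(1)`. -/
  | red1 (P : DepPrefix) (Γ : List Formula) (L : Formula) (u : ℕ) :
      L ∈ Γ → u ∈ P.univ → (∀ x ∈ L.vars, x ∈ P.exis → u ∉ P.dep x) →
      Step F M ⟨P, Γ⟩ ⟨P, L.replace u Formula.tru :: Γ⟩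
  /-- Weakening of the quantifiers by a new existential variable. -/
  | weakenExists (P : DepPrefix) (Γ : List Formula) (v : ℕ) (D : Finset ℕ)
      (hv : v ∉ P.vars) (hD : D ⊆ P.univ) :
      Step F M ⟨P, Γ⟩ ⟨P.addExists v D hv hD, Γ⟩
  /-- Weakening of the quantifiers by a new universal variable. -/
  | weakenForall (P : DepPrefix) (Γ : List Formula) (v : ℕ) (hv : v ∉ P.vars) :
      Step F M ⟨P, Γ⟩ ⟨P.addForall v hv, Γ⟩

/-- `Derives F Q n s`: the stage `s` is reached from the DQBF `Q` by exactly `n` rule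
applications of dFrege+∀red. -/
inductive Derives (F : FregeSystem) (Q : DQBF) : ℕ → Stage → Prop
  | start : Derives F Q 0 ⟨Q.pre, []⟩
  | step {n : ℕ} {s t : Stage} : Derives F Q n s →
      Step F {L | ∃ K ∈ Q.matrix, L = clauseFormula K} s t → Derives F Q (n + 1) t

/-! ### Unit propagation -/

/-- The literals that unit propagation on `φ` makes true: `l` is propagated when it is
the only literal left in some clause after deleting falsified literals. -/
inductive Propagates (φ : CNF) : Literal → Prop
  | unit {K : Clause} {l : Literal} : K ∈ φ → l ∈ K →
      (∀ k ∈ K, k ≠ l → Propagates φ k.neg) → Propagates φ l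

/-- `φ ⊢₁ ⊥`: unit propagation deletes all the literals of some clause of `φ`. -/
def UnitRefutes (φ : CNF) : Prop :=
  ∃ K ∈ φ, ∀ k ∈ K, Propagates φ k.neg

/-- The negation of a clause, as a conjunction of unit clauses. -/
def negClause (C : Clause) : CNF := C.image fun l => {l.neg}

/-! ### Resolution paths and outer clauses -/

/-- The `S`-literals on the resolution paths in `φ` from `χ`. -/
inductive PathLit (φ χ : CNF) (S : Set ℕ) : Literal → Prop
  | init {K : Clause} {l : Literal} : K ∈ χ → l ∈ K → l.var ∈ S → PathLit φ χ S l
  | step {p q : Literal} {D : Clause} : PathLit φ χ S p → D ∈ φ → p.neg ∈ D →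
      q ∈ D → q ≠ p.neg → q.var ∈ S → PathLit φ χ S q

/-- The clauses on the resolution paths in `φ` from `χ`. -/
def PathClause (φ χ : CNF) (S : Set ℕ) (D : Clause) : Prop :=
  D ∈ χ ∨ (D ∈ φ ∧ ∃ p, PathLit φ χ S p ∧ p.neg ∈ D)

namespace DepPrefix

/-- `𝒮`: the existential variables that depend on the universal variable `u`. -/
def dependents (P : DepPrefix) (u : ℕ) : Finset ℕ := {x ∈ P.exis | u ∈ P.dep x}

/-- `T`: the universal variables other than `u` on which all variables in `𝒮` depend. -/
def commonDeps (P : DepPrefix) (u : ℕ) : Finset ℕ :=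
  {w ∈ P.univ | w ≠ u ∧ ∀ x ∈ P.dependents u, w ∈ P.dep x}

/-- The outer clause `O_D` of `D` with respect to the universal variable `u`. -/
def outerClause (P : DepPrefix) (u : ℕ) (D : Clause) : Clause :=
  {k ∈ D | (k.var ∈ P.exis ∧ P.dep k.var ⊆ P.commonDeps u) ∨
    (k.var ∈ P.univ ∧ k.var ∈ P.commonDeps u)}

end DepPrefix

/-- The copy of a clause in which every variable `x` is replaced by `ρ x`. -/
def renameClause (ρ : ℕ → ℕ) (K : Clause) : Clause := K.image fun l => ⟨ρ l.var, l.pos⟩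

end DFrege

/-!
Write `x⁰` for the value of `x ∈ 𝒮` when `u` is false. Independent extension under the condition `ū`
defines it by a variable whose dependency set no longer contains the variable of `u`. Substituting
`x⁰` for `x` in a clause `K` with `ū ∉ K` gives a disjunction of `u` with a restricted clause in
which nothing depends on `u` any more, and the reduction rule removes `u` from it.

Let `w` be the conjunction of `u` and of the outer clauses `O_D` of all reachable clauses `D` with
`ū ∈ D`. The variables of these outer clauses have dependency sets inside `T`, so that of `w` lies
in `D_x` for every `x ∈ 𝒮`, and `w` may occur in the definition of the copy `x'`. If `w` is false,
then `C` is true: either `u` is false and `C` follows from `C ∨ u`, or some `O_D` is false and unit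
propagation derives `C` from `φ`. In this case one takes `x' = x`. If `w` is true, then `x'` is `x⁰`
if both `x` and `x̄` are path literals, `x ∨ x⁰` if only `x` is, `x ∧ x⁰` if only `x̄` is, and `x`
otherwise.

Let `w` be true. A true literal `l` remains true in the copy if `l̄` is no path literal, and a
literal `l` with a true restriction becomes true in the copy if `l` is a path literal. A clause `K`
without `u` and `ū` contains a true literal and one whose restriction is true. By the closure
property of path literals one of these two cases applies, unless both are the same literal, and then
it is true in the copy because `x'` lies between `x` and `x⁰`. A clause with `ū` either is
reachable, and its outer clause is true and does not change, or all its literals remain true. A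
clause with `u` is true because `w` implies `u`, and `C` becomes true because its restriction is
true and all its literals over `𝒮` are path literals.
-/

namespace DFrege

variable {Γ Δ : Set Formula} {n m k : ℕ} {A B G : Formula}

namespace Formula

/-- The number of nodes of a formula, where a variable counts with its index, so that only
finitely many formulas have bounded weight. -/
def weight : Formula → ℕ
  | fls => 1
  | tru => 1
  | var x => x + 1
  | neg a => a.weight + 1
  | and a b => a.weight + b.weight + 1
  | or a b => a.weight + b.weight + 1
  | imp a b => a.weight + b.weight + 1
  | iff a b => a.weight + b.weight + 1

theorem weight_pos (A : Formula) : 0 < A.weight := by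
  cases A <;> simp [weight]

theorem finite_weight_le (n : ℕ) : {A : Formula | A.weight ≤ n}.Finite := by
  induction n with
  | zero => exact Set.finite_empty.subset fun A hA => (weight_pos A).not_ge hA
  | succ n ih =>
    refine ((((((((Set.finite_singleton fls).union (Set.finite_singleton tru)).union
      ((Set.finite_Iic n).image var)).union (ih.image neg)).union (ih.image2 and ih)).union
      (ih.image2 or ih)).union (ih.image2 imp ih)).union (ih.image2 iff ih)).subset ?_
    intro A hA
    cases A <;> simp [weight] at hA ⊢ <;> omega

theorem subst_subst (σ τ : ℕ → Formula) (A : Formula) :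
    (A.subst σ).subst τ = A.subst fun i => (σ i).subst τ := by
  induction A <;> simp_all [subst]

theorem subst_eq_self {σ : ℕ → Formula} (h : ∀ x ∈ A.vars, σ x = var x) : A.subst σ = A := by
  induction A <;> simp_all [subst, vars]

theorem vars_subst_subset {σ : ℕ → Formula} {V : Finset ℕ}
    (h : ∀ x ∈ A.vars, (σ x).vars ⊆ V) : (A.subst σ).vars ⊆ V := by
  induction A <;> simp_all [subst, vars, Finset.union_subset_iff]

theorem vars_bigAnd_subset {l : List Formula} {V : Finset ℕ} (h : ∀ A ∈ l, A.vars ⊆ V) :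
    (bigAnd l).vars ⊆ V := by
  induction l <;> simp_all [bigAnd, vars, Finset.union_subset_iff]

theorem vars_bigOr_subset {l : List Formula} {V : Finset ℕ} (h : ∀ A ∈ l, A.vars ⊆ V) :
    (bigOr l).vars ⊆ V := by
  induction l <;> simp_all [bigOr, vars, Finset.union_subset_iff]

end Formula

open Formula

@[simp]
theorem Literal.vars_toFormula (l : Literal) : l.toFormula.vars = {l.var} := by
  rcases l with ⟨x, _ | _⟩ <;> rfl

@[simp]
theorem Literal.neg_neg (l : Literal) : l.neg.neg = l := by
  simp [Literal.neg]

theorem vars_clauseFormula_subset {K : Clause} {V : Finset ℕ} (h : ∀ l ∈ K, l.var ∈ V) :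
    (clauseFormula K).vars ⊆ V :=
  vars_bigOr_subset (by simpa using h)

theorem vars_conjFormula_subset {Y : Finset Literal} {V : Finset ℕ} (h : ∀ l ∈ Y, l.var ∈ V) :
    (conjFormula Y).vars ⊆ V :=
  vars_bigAnd_subset (by simpa using h)

namespace FregeRule

/-- Soundness of a schematic rule. -/
def IsSound (r : FregeRule) : Prop :=
  ∀ v : ℕ → Prop, (∀ A ∈ r.premises, A.Holds v) → r.conclusion.Holds v

/-- The total weight of the formulas in a rule. -/
def weight (r : FregeRule) : ℕ := (r.premises.map Formula.weight).sum + r.conclusion.weight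

theorem finite_weight_le (n : ℕ) : {r : FregeRule | r.weight ≤ n}.Finite := by
  have hlists : {l : List Formula | (∀ A ∈ l, A.weight ≤ n) ∧ l.length ≤ n}.Finite := by
    have : Finite {A : Formula // A.weight ≤ n} := (Formula.finite_weight_le n).to_subtype
    refine ((List.finite_length_le {A : Formula // A.weight ≤ n} n).image
      (List.map Subtype.val)).subset fun l hl => ?_
    exact ⟨l.attachWith _ hl.1, by simpa using hl.2, by simp⟩
  refine ((hlists.prod (Formula.finite_weight_le n)).image fun p => ⟨p.1, p.2⟩).subset ?_
  intro ⟨l, B⟩ (hr : (l.map Formula.weight).sum + B.weight ≤ n)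
  refine ⟨(l, B), ⟨⟨fun A hA => ?_, ?_⟩, (Nat.le_add_left _ _).trans hr⟩, rfl⟩
  · have := List.single_le_sum (by simp) _ (List.mem_map_of_mem (f := Formula.weight) hA)
    exact this.trans ((Nat.le_add_right _ _).trans hr)
  · have := List.length_le_sum_of_one_le (l.map Formula.weight)
      (List.forall_mem_map.2 fun A _ => A.weight_pos)
    rw [List.length_map] at this
    exact this.trans ((Nat.le_add_right _ _).trans hr)

end FregeRule

/-- `Prov Γ n A`: the formula `A` has a proof from `Γ` with at most `n` instances of sound rules
of weight at most `100`. The bound is arbitrary: it exceeds the weight of every rule used below,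
and it makes the set of these rules finite, so that a Frege system simulates each of them in a
constant number of steps. -/
inductive Prov : Set Formula → ℕ → Formula → Prop
  | hyp {Γ : Set Formula} {n : ℕ} {A : Formula} : A ∈ Γ → Prov Γ n A
  | cut {Γ : Set Formula} {n m : ℕ} {A B : Formula} :
      Prov Γ n A → Prov (insert A Γ) m B → Prov Γ (n + m) B
  | rule {Γ : Set Formula} {r : FregeRule} (σ : ℕ → Formula) : r.IsSound → r.weight ≤ 100 →
      (∀ A ∈ r.premises, A.subst σ ∈ Γ) → Prov Γ 1 (r.conclusion.subst σ)

namespace Prov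

theorem mono (h : Prov Γ n A) (hΓ : Γ ⊆ Δ) : Prov Δ n A := by
  induction h generalizing Δ with
  | hyp h => exact .hyp (hΓ h)
  | cut _ _ ih ih' => exact .cut (ih hΓ) (ih' (Set.insert_subset_insert hΓ))
  | rule σ hr hw h => exact .rule σ hr hw fun A hA => hΓ (h A hA)

theorem le (h : Prov Γ n A) (hn : n ≤ m) : Prov Γ m A := by
  obtain ⟨k, rfl⟩ := Nat.exists_eq_add_of_le hn
  exact h.cut (.hyp (Set.mem_insert A Γ))

theorem weaken (h : Prov Γ n A) : Prov (insert B Γ) n A := h.mono (Set.subset_insert B Γ)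

theorem rule₀ (l : List Formula) (B : Formula)
    (hB : FregeRule.IsSound ⟨[], B⟩ := by intro v; simp [Holds] <;> tauto)
    (hw : FregeRule.weight ⟨[], B⟩ ≤ 100 := by decide) :
    Prov Γ 1 (B.subst fun i => l.getD i tru) :=
  rule (r := ⟨[], B⟩) _ hB hw (by simp)

theorem rule₁ (l : List Formula) (A B : Formula) (h : Prov Γ n (A.subst fun i => l.getD i tru))
    (hB : FregeRule.IsSound ⟨[A], B⟩ := by intro v; simp [Holds] <;> tauto)
    (hw : FregeRule.weight ⟨[A], B⟩ ≤ 100 := by decide) :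
    Prov Γ (n + 1) (B.subst fun i => l.getD i tru) :=
  h.cut (rule (r := ⟨[A], B⟩) _ hB hw (by simp))

theorem rule₂ (l : List Formula) (A₁ A₂ B : Formula)
    (h₁ : Prov Γ n (A₁.subst fun i => l.getD i tru))
    (h₂ : Prov Γ m (A₂.subst fun i => l.getD i tru))
    (hB : FregeRule.IsSound ⟨[A₁, A₂], B⟩ := by intro v; simp [Holds] <;> tauto)
    (hw : FregeRule.weight ⟨[A₁, A₂], B⟩ ≤ 100 := by decide) :
    Prov Γ (n + m + 1) (B.subst fun i => l.getD i tru) :=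
  (h₁.cut (h₂.weaken.cut (rule (r := ⟨[A₁, A₂], B⟩) _ hB hw (by simp)))).le (by omega)

theorem rule₃ (l : List Formula) (A₁ A₂ A₃ B : Formula)
    (h₁ : Prov Γ n (A₁.subst fun i => l.getD i tru))
    (h₂ : Prov Γ m (A₂.subst fun i => l.getD i tru))
    (h₃ : Prov Γ k (A₃.subst fun i => l.getD i tru))
    (hB : FregeRule.IsSound ⟨[A₁, A₂, A₃], B⟩ := by intro v; simp [Holds] <;> tauto)
    (hw : FregeRule.weight ⟨[A₁, A₂, A₃], B⟩ ≤ 100 := by decide) :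
    Prov Γ (n + m + k + 1) (B.subst fun i => l.getD i tru) :=
  (h₁.cut (h₂.weaken.cut (h₃.weaken.weaken.cut
    (rule (r := ⟨[A₁, A₂, A₃], B⟩) _ hB hw (by simp))))).le (by omega)

theorem mp (h : Prov Γ n (imp A B)) (h' : Prov Γ m A) : Prov Γ (n + m + 1) B :=
  rule₂ [A, B] (imp (var 0) (var 1)) (var 0) (var 1) h h'

theorem imp_const (h : Prov Γ n B) : Prov Γ (n + 1) (imp A B) :=
  rule₁ [A, B] (var 1) (imp (var 0) (var 1)) h

theorem imp_trans (h : Prov Γ n (imp A B)) (h' : Prov Γ m (imp B G)) :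
    Prov Γ (n + m + 1) (imp A G) :=
  rule₂ [A, B, G] (imp (var 0) (var 1)) (imp (var 1) (var 2)) (imp (var 0) (var 2)) h h'

theorem bigOr_imp {l : List Formula} (h : ∀ A ∈ l, Prov Γ n (imp A B)) :
    Prov Γ (l.length * (n + 1) + 1) (imp (bigOr l) B) := by
  induction l with
  | nil => exact (rule₀ [B] (imp fls (var 0))).le (by simp)
  | cons A l ih =>
    refine (rule₂ [A, B, bigOr l] (imp (var 0) (var 1)) (imp (var 2) (var 1))
      (imp (or (var 0) (var 2)) (var 1)) (h A (by simp)) (ih fun A hA => h A (by simp [hA]))).le ?_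
    simp only [List.length_cons]
    ring_nf
    rfl

theorem imp_bigOr {l : List Formula} (h : A ∈ l) : Prov Γ l.length (imp A (bigOr l)) := by
  induction l with
  | nil => simp at h
  | cons B l ih =>
    rcases List.mem_cons.1 h with rfl | h
    · exact (rule₀ [A, bigOr l] (imp (var 0) (or (var 0) (var 1)))).le (by simp)
    · exact rule₁ [A, bigOr l, B] (imp (var 0) (var 1)) (imp (var 0) (or (var 2) (var 1))) (ih h)

theorem imp_bigAnd {l : List Formula} (h : ∀ A ∈ l, Prov Γ n (imp B A)) :
    Prov Γ (l.length * (n + 1) + 1) (imp B (bigAnd l)) := by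
  induction l with
  | nil => exact (rule₀ [B] (imp (var 0) tru)).le (by simp)
  | cons A l ih =>
    refine (rule₂ [A, B, bigAnd l] (imp (var 1) (var 0)) (imp (var 1) (var 2))
      (imp (var 1) (and (var 0) (var 2))) (h A (by simp)) (ih fun A hA => h A (by simp [hA]))).le ?_
    simp only [List.length_cons]
    ring_nf
    rfl

theorem bigAnd_imp {l : List Formula} (h : A ∈ l) : Prov Γ l.length (imp (bigAnd l) A) := by
  induction l with
  | nil => simp at h
  | cons B l ih =>
    rcases List.mem_cons.1 h with rfl | h
    · exact (rule₀ [A, bigAnd l] (imp (and (var 0) (var 1)) (var 0))).le (by simp)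
    · exact rule₁ [A, bigAnd l, B] (imp (var 1) (var 0)) (imp (and (var 2) (var 1)) (var 0)) (ih h)

theorem clauseFormula_imp {K : Clause} (h : ∀ l ∈ K, Prov Γ n (imp l.toFormula B)) :
    Prov Γ (K.card * (n + 1) + 1) (imp (clauseFormula K) B) := by
  simpa [clauseFormula] using
    bigOr_imp (Γ := Γ) (n := n) (B := B) (l := K.toList.map Literal.toFormula) (by simpa using h)

theorem imp_clauseFormula {K : Clause} {l : Literal} (h : l ∈ K) :
    Prov Γ K.card (imp l.toFormula (clauseFormula K)) := by
  simpa [clauseFormula] using imp_bigOr (Γ := Γ) (l := K.toList.map Literal.toFormula)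
    (List.mem_map_of_mem (by simpa using h))

theorem imp_conjFormula {Y : Finset Literal} (h : ∀ l ∈ Y, Prov Γ n (imp B l.toFormula)) :
    Prov Γ (Y.card * (n + 1) + 1) (imp B (conjFormula Y)) := by
  simpa [conjFormula] using
    imp_bigAnd (Γ := Γ) (n := n) (B := B) (l := Y.toList.map Literal.toFormula) (by simpa using h)

theorem conjFormula_imp {Y : Finset Literal} {l : Literal} (h : l ∈ Y) :
    Prov Γ Y.card (imp (conjFormula Y) l.toFormula) := by
  simpa [conjFormula] using bigAnd_imp (Γ := Γ) (l := Y.toList.map Literal.toFormula)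
    (List.mem_map_of_mem (by simpa using h))

theorem clause_cases {K : Clause} (hK : Prov Γ n (imp A (clauseFormula K)))
    (h : ∀ l ∈ K, Prov Γ m (imp l.toFormula (imp A B))) :
    Prov Γ (n + K.card * (m + 1) + 2) (imp A B) :=
  (rule₂ [A, B, clauseFormula K] (imp (var 0) (var 2)) (imp (var 2) (imp (var 0) (var 1)))
    (imp (var 0) (var 1)) hK (clauseFormula_imp h)).le (by omega)

theorem neg_literal_iff (l : Literal) :
    Prov Γ 1 (iff l.neg.toFormula (neg l.toFormula)) := by
  obtain ⟨x, _ | _⟩ := l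
  · exact rule₀ [var x] (iff (var 0) (neg (neg (var 0))))
  · exact rule₀ [var x] (iff (neg (var 0)) (neg (var 0)))

theorem conjFormula_pair_iff (a b : Literal) :
    Prov Γ 10 (iff (conjFormula {a, b}) (and a.toFormula b.toFormula)) := by
  have hcard := Finset.card_le_two (a := a) (b := b)
  have intro_pair : Prov Γ 5 (imp (and a.toFormula b.toFormula) (conjFormula {a, b})) := by
    refine (imp_conjFormula (n := 1) ?_).le (by omega)
    simp only [Finset.mem_insert, Finset.mem_singleton, forall_eq_or_imp, forall_eq]
    exact ⟨rule₀ [a.toFormula, b.toFormula] (imp (and (var 0) (var 1)) (var 0)),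
      rule₀ [a.toFormula, b.toFormula] (imp (and (var 0) (var 1)) (var 1))⟩
  exact rule₃ [conjFormula {a, b}, a.toFormula, b.toFormula] (imp (and (var 1) (var 2)) (var 0))
    (imp (var 0) (var 1)) (imp (var 0) (var 2)) (iff (var 0) (and (var 1) (var 2))) intro_pair
    ((conjFormula_imp (by simp)).le hcard) ((conjFormula_imp (by simp)).le hcard)

theorem clauseFormula_pair_iff (a b : Literal) :
    Prov Γ 10 (iff (clauseFormula {a, b}) (or a.toFormula b.toFormula)) := by
  have hcard := Finset.card_le_two (a := a) (b := b)
  have elim_pair : Prov Γ 5 (imp (clauseFormula {a, b}) (or a.toFormula b.toFormula)) := by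
    refine (clauseFormula_imp (n := 1) ?_).le (by omega)
    simp only [Finset.mem_insert, Finset.mem_singleton, forall_eq_or_imp, forall_eq]
    exact ⟨rule₀ [a.toFormula, b.toFormula] (imp (var 0) (or (var 0) (var 1))),
      rule₀ [a.toFormula, b.toFormula] (imp (var 1) (or (var 0) (var 1)))⟩
  exact rule₃ [clauseFormula {a, b}, a.toFormula, b.toFormula] (imp (var 0) (or (var 1) (var 2)))
    (imp (var 1) (var 0)) (imp (var 2) (var 0)) (iff (var 0) (or (var 1) (var 2))) elim_pair
    ((imp_clauseFormula (by simp)).le hcard) ((imp_clauseFormula (by simp)).le hcard)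

end Prov

section UnitPropagation

variable {θ : CNF}

theorem UnitRefutes.exists_unit_clause (h : UnitRefutes θ) (Y : Finset Literal) :
    (∃ K ∈ θ, ∀ k ∈ K, k.neg ∈ Y) ∨
      ∃ K ∈ θ, ∃ l ∈ K, l ∉ Y ∧ ∀ k ∈ K, k ≠ l → k.neg ∈ Y := by
  by_contra! hY
  have propagates_mem {l : Literal} (hl : Propagates θ l) : l ∈ Y := by
    induction hl with
    | @unit K l hK hl _ ih =>
      by_contra hlY
      obtain ⟨k, hk, hkl, hkY⟩ := hY.2 K hK l hl hlY
      exact hkY (ih k hk hkl)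
  obtain ⟨K, hK, hKneg⟩ := h
  obtain ⟨k, hk, hkY⟩ := hY.1 K hK
  exact hkY (propagates_mem (hKneg k hk))

theorem Prov.imp_of_unit_clause {K : Clause} (hK : Prov Γ n (imp A (clauseFormula K)))
    (h : ∀ l ∈ K, l.toFormula = B ∨ imp A l.neg.toFormula ∈ Γ) :
    Prov Γ (n + 3 * K.card + 2) (imp A B) := by
  refine (hK.clause_cases (m := 2) fun l hl => ?_).le (by omega)
  rcases h l hl with rfl | h
  · exact (rule₀ [A, l.toFormula] (imp (var 1) (imp (var 0) (var 1)))).le one_le_two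
  · exact rule₂ [A, B, l.toFormula, l.neg.toFormula] (imp (var 0) (var 3))
      (iff (var 3) (neg (var 2))) (imp (var 2) (imp (var 0) (var 1)))
      (.hyp (n := 0) h) (neg_literal_iff l)

theorem Prov.imp_fls_of_unitRefutes {b : ℕ} {Y : Finset Literal} (h : UnitRefutes θ)
    (hθ : ∀ K ∈ θ, Prov Γ n (imp A (clauseFormula K))) (hb : ∀ K ∈ θ, K.card ≤ b)
    (hY : ∀ l ∈ Y, imp A l.toFormula ∈ Γ) :
    Prov Γ (((θ.biUnion id \ Y).card + 1) * (n + 3 * b + 2)) (imp A fls) := by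
  induction hN : (θ.biUnion id \ Y).card using Nat.strong_induction_on generalizing Y Γ with
  | h N ih =>
    rcases h.exists_unit_clause Y with ⟨K, hK, hKneg⟩ | ⟨K, hK, l, hl, hlY, hKneg⟩
    · refine ((hθ K hK).imp_of_unit_clause fun k hk => .inr (hY _ (hKneg k hk))).le ?_
      have := hb K hK
      nlinarith
    · have unit : Prov Γ (n + 3 * b + 2) (imp A l.toFormula) := by
        refine ((hθ K hK).imp_of_unit_clause fun k hk => ?_).le (by have := hb K hK; omega)
        by_cases hkl : k = l
        · exact .inl (by rw [hkl])
        · exact .inr (hY _ (hKneg k hk hkl))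
      have hlt : (θ.biUnion id \ insert l Y).card < N := by
        rw [← hN, Finset.sdiff_insert]
        exact Finset.card_erase_lt_of_mem
          (Finset.mem_sdiff.2 ⟨Finset.mem_biUnion.2 ⟨K, hK, hl⟩, hlY⟩)
      refine (unit.cut (ih _ hlt (fun K hK => (hθ K hK).weaken) (Y := insert l Y) ?_ rfl)).le ?_
      · simpa using fun k hk => Or.inr (hY k hk)
      · nlinarith

theorem Prov.imp_of_mem_negClause {K K' : Clause} (hK : Prov Γ n (imp A (neg (clauseFormula K))))
    (hK' : K' ∈ negClause K) : Prov Γ (n + K.card + 2) (imp A (clauseFormula K')) := by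
  obtain ⟨l, hl, rfl⟩ := Finset.mem_image.1 hK'
  have unit : clauseFormula {l.neg} = or l.neg.toFormula fls := by simp [clauseFormula, bigOr]
  rw [unit]
  exact rule₃ [A, clauseFormula K, l.toFormula, l.neg.toFormula]
    (imp (var 0) (neg (var 1))) (imp (var 2) (var 1)) (iff (var 3) (neg (var 2)))
    (imp (var 0) (or (var 3) fls)) hK (imp_clauseFormula hl) (neg_literal_iff l)

theorem Prov.neg_imp_of_unitRefutes {φ : CNF} {C O : Clause} {b : ℕ}
    (h : UnitRefutes (φ ∪ negClause C ∪ negClause O))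
    (hφ : ∀ K ∈ φ, clauseFormula K ∈ Γ) (hφb : ∀ K ∈ φ, K.card ≤ b) (hφcard : φ.card ≤ b)
    (hC : C.card ≤ b) (hO : O.card ≤ b) :
    Prov Γ (12 * (b + 1) ^ 3) (imp (neg (clauseFormula C)) (clauseFormula O)) := by
  set A := and (neg (clauseFormula C)) (neg (clauseFormula O))
  have hAC : Prov Γ 1 (imp A (neg (clauseFormula C))) :=
    rule₀ [clauseFormula C, clauseFormula O] (imp (and (neg (var 0)) (neg (var 1))) (neg (var 0)))
  have hAO : Prov Γ 1 (imp A (neg (clauseFormula O))) :=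
    rule₀ [clauseFormula C, clauseFormula O] (imp (and (neg (var 0)) (neg (var 1))) (neg (var 1)))
  set θ := φ ∪ negClause C ∪ negClause O
  have hθ : ∀ K ∈ θ, Prov Γ (b + 3) (imp A (clauseFormula K)) ∧ K.card ≤ b + 1 := by
    have card_of_mem_negClause {K K' : Clause} (h : K' ∈ negClause K) : K'.card ≤ b + 1 := by
      obtain ⟨l, -, rfl⟩ := Finset.mem_image.1 h
      simp
    intro K hK
    rcases Finset.mem_union.1 hK with hK | hK
    · rcases Finset.mem_union.1 hK with hK | hK
      · exact ⟨(imp_const (.hyp (n := 0) (hφ K hK))).le (by omega), (hφb K hK).trans (by omega)⟩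
      · exact ⟨(hAC.imp_of_mem_negClause hK).le (by omega), card_of_mem_negClause hK⟩
    · exact ⟨(hAO.imp_of_mem_negClause hK).le (by omega), card_of_mem_negClause hK⟩
  have hcard : (θ.biUnion id).card ≤ 3 * b * (b + 1) := by
    have hθcard : θ.card ≤ φ.card + C.card + O.card :=
      (Finset.card_union_le _ _).trans (add_le_add ((Finset.card_union_le _ _).trans
        (Nat.add_le_add_left Finset.card_image_le _)) Finset.card_image_le)
    exact (Finset.card_biUnion_le_card_mul _ _ _ fun K hK => (hθ K hK).2).trans
      (Nat.mul_le_mul_right _ (by omega))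
  have refutation : Prov Γ ((3 * b * (b + 1) + 1) * (4 * b + 8)) (imp A fls) := by
    refine (imp_fls_of_unitRefutes (Y := ∅) h (fun K hK => (hθ K hK).1) (fun K hK => (hθ K hK).2)
      (by simp)).le (Nat.mul_le_mul ?_ (by omega))
    simpa using hcard
  exact (rule₁ [clauseFormula C, clauseFormula O] (imp (and (neg (var 0)) (neg (var 1))) fls)
    (imp (neg (var 0)) (var 1)) refutation).le (by ring_nf; omega)

end UnitPropagation

/-! ### Stages of a derivation -/

namespace DepPrefix

variable {P P' P'' : DepPrefix} {D E : Finset ℕ} {v x : ℕ}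

/-- `P ≤ P'` if `P'` arises from `P` by adding existential variables. -/
instance : Preorder DepPrefix where
  le P P' := P'.univ = P.univ ∧ P.exis ⊆ P'.exis ∧ ∀ x ∈ P.exis, P'.dep x = P.dep x
  le_refl _ := ⟨rfl, subset_rfl, fun _ _ => rfl⟩
  le_trans _ _ _ h h' := ⟨h'.1.trans h.1, h.2.1.trans h'.2.1,
    fun x hx => (h'.2.2 x (h.2.1 hx)).trans (h.2.2 x hx)⟩

theorem univ_eq_of_le (h : P ≤ P') : P'.univ = P.univ := h.1

theorem exis_subset_of_le (h : P ≤ P') : P.exis ⊆ P'.exis := h.2.1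

theorem dep_eq_of_le (h : P ≤ P') (hx : x ∈ P.exis) : P'.dep x = P.dep x := h.2.2 x hx

theorem vars_subset_of_le (h : P ≤ P') : P.vars ⊆ P'.vars :=
  Finset.union_subset_union (univ_eq_of_le h).ge (exis_subset_of_le h)

theorem notMem_exis_of_mem_univ (hx : x ∈ P.univ) : x ∉ P.exis :=
  fun h => Finset.disjoint_left.1 P.disjoint hx h

theorem depSet_of_mem_exis (hx : x ∈ P.exis) : P.depSet x = P.dep x := if_pos hx

theorem depSet_of_mem_univ (hx : x ∈ P.univ) : P.depSet x = {x} :=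
  if_neg (notMem_exis_of_mem_univ hx)

theorem depSet_eq_of_le (h : P ≤ P') (hx : x ∈ P.vars) : P'.depSet x = P.depSet x := by
  rcases Finset.mem_union.1 hx with hx | hx
  · rw [depSet_of_mem_univ hx, depSet_of_mem_univ ((univ_eq_of_le h).symm ▸ hx)]
  · rw [depSet_of_mem_exis hx, depSet_of_mem_exis (exis_subset_of_le h hx), dep_eq_of_le h hx]

theorem le_addExists (hv : v ∉ P.vars) (hD : D ⊆ P.univ) : P ≤ P.addExists v D hv hD :=
  ⟨rfl, Finset.subset_insert _ _, fun _ hx =>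
    Function.update_of_ne (ne_of_mem_of_not_mem hx fun h => hv (Finset.mem_union_right _ h)) _ _⟩

/-- The quantified variables whose dependency set lies in `D`. -/
def varsWithin (P : DepPrefix) (D : Finset ℕ) : Finset ℕ := {x ∈ P.vars | P.depSet x ⊆ D}

theorem varsWithin_subset_vars : P.varsWithin D ⊆ P.vars := Finset.filter_subset _ _

theorem varsWithin_subset_of_subset (h : D ⊆ E) : P.varsWithin D ⊆ P.varsWithin E :=
  Finset.monotone_filter_right _ fun _ _ hx => hx.trans h

theorem varsWithin_subset_of_le (h : P ≤ P') : P.varsWithin D ⊆ P'.varsWithin D := by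
  intro x hx
  obtain ⟨hx, hD⟩ := Finset.mem_filter.1 hx
  exact Finset.mem_filter.2 ⟨vars_subset_of_le h hx, by rwa [depSet_eq_of_le h hx]⟩

theorem mem_varsWithin_of_mem_univ (hx : x ∈ P.univ) (hD : x ∈ D) : x ∈ P.varsWithin D :=
  Finset.mem_filter.2 ⟨Finset.mem_union_left _ hx, by simpa [depSet_of_mem_univ hx] using hD⟩

theorem mem_varsWithin_of_mem_exis (hx : x ∈ P.exis) (hD : P.dep x ⊆ D) : x ∈ P.varsWithin D :=
  Finset.mem_filter.2 ⟨Finset.mem_union_right _ hx, by simpa [depSet_of_mem_exis hx] using hD⟩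

/-- The variable `v` is an existential variable of `P'` but no variable of `P`, and its dependency
set lies in `D`. -/
structure IsNewVar (P P' : DepPrefix) (v : ℕ) (D : Finset ℕ) : Prop where
  notMem_vars : v ∉ P.vars
  mem_exis : v ∈ P'.exis
  dep_subset : P'.dep v ⊆ D

theorem IsNewVar.mono (h : IsNewVar P P' v D) (hP : P'' ≤ P) : IsNewVar P'' P' v D :=
  ⟨fun hv => h.notMem_vars (vars_subset_of_le hP hv), h.mem_exis, h.dep_subset⟩

theorem IsNewVar.trans_le (h : IsNewVar P P' v D) (hP : P' ≤ P'') : IsNewVar P P'' v D :=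
  ⟨h.notMem_vars, exis_subset_of_le hP h.mem_exis, dep_eq_of_le hP h.mem_exis ▸ h.dep_subset⟩

theorem IsNewVar.mem_varsWithin (h : IsNewVar P P' v D) : v ∈ P'.varsWithin D :=
  mem_varsWithin_of_mem_exis h.mem_exis h.dep_subset

theorem isNewVar_addExists (hv : v ∉ P.vars) (hD : D ⊆ P.univ) (hE : D ⊆ E) :
    IsNewVar P (P.addExists v D hv hD) v E :=
  ⟨hv, Finset.mem_insert_self _ _, (Function.update_self v D P.dep).trans_subset hE⟩

theorem extDep_subset_of_varsWithin {α Y : Finset Literal}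
    (hY : ∀ y ∈ Y, y.var ∈ P.varsWithin (D ∪ α.image Literal.var)) : P.extDep α Y ⊆ D :=
  sdiff_le_iff'.2 (Finset.biUnion_subset.2 fun y hy => (Finset.mem_filter.1 (hY y hy)).2)

end DepPrefix

/-- `s ≤ t` if the quantifiers and the lines of `t` extend those of `s`. -/
instance : Preorder Stage where
  le s t := s.pre ≤ t.pre ∧ s.lines ⊆ t.lines
  le_refl _ := ⟨le_rfl, List.Subset.refl _⟩
  le_trans _ _ _ h h' := ⟨h.1.trans h'.1, List.Subset.trans h.2 h'.2⟩

/-- `DerivesWithin F Q n s`: the stage `s` is reached from `Q` by at most `n` rule applications. -/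
def DerivesWithin (F : FregeSystem) (Q : DQBF) (n : ℕ) (s : Stage) : Prop :=
  ∃ k ≤ n, Derives F Q k s

section Stages

variable {F : FregeSystem} {Q : DQBF} {k l n : ℕ} {s t : Stage} {R R' : Stage → Prop} {L : Formula}

theorem Step.vars_pre_subset {M : Set Formula} (h : Step F M s t) : s.pre.vars ⊆ t.pre.vars := by
  cases h with
  | indExtAnd | indExtOr | weakenExists =>
    exact Finset.union_subset_union_right (Finset.subset_insert _ _)
  | weakenForall => exact Finset.union_subset_union_left (Finset.subset_insert _ _)
  | _ => exact subset_rfl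

theorem Formula.vars_replace_subset {u : ℕ} {b : Formula} (hb : b.vars = ∅) :
    (L.replace u b).vars ⊆ L.vars := by
  refine vars_subst_subset fun x hx => ?_
  by_cases h : x = u
  · subst h
    simp [hb]
  · simpa [Function.update_of_ne h, vars] using hx

theorem Formula.vars_extension_subset {α : Finset Literal} {V : Finset ℕ} {v : ℕ} {A : Formula}
    (hα : ∀ a ∈ α, a.var ∈ V) (hv : v ∈ V) (hA : A.vars ⊆ V) :
    (imp (conjFormula α) (iff (var v) A)).vars ⊆ V :=
  Finset.union_subset (vars_conjFormula_subset hα)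
    (Finset.union_subset (Finset.singleton_subset_iff.2 hv) hA)

theorem Step.vars_lines_subset {M : Set Formula} (h : Step F M s t)
    (hM : ∀ L ∈ M, L.vars ⊆ s.pre.vars) (hs : ∀ L ∈ s.lines, L.vars ⊆ s.pre.vars) :
    ∀ L ∈ t.lines, L.vars ⊆ t.pre.vars := by
  have hsub := h.vars_pre_subset
  have hst {L : Formula} (hL : L.vars ⊆ t.pre.vars) :
      ∀ A ∈ L :: s.lines, A.vars ⊆ t.pre.vars :=
    List.forall_mem_cons.2 ⟨hL, fun A hA => (hs A hA).trans hsub⟩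
  cases h with
  | ax P Γ L hL => exact hst (hM L hL)
  | frege P Γ r σ hr hprem hvars => exact hst hvars
  | indExtAnd P Γ α Y v hα hY hv =>
    exact hst (vars_extension_subset (fun a ha => hsub (Finset.mem_union_left _ (hα a ha)))
      (Finset.mem_union_right _ (Finset.mem_insert_self v P.exis))
      (vars_conjFormula_subset fun y hy => hsub (hY y hy)))
  | indExtOr P Γ α Y v hα hY hv =>
    exact hst (vars_extension_subset (fun a ha => hsub (Finset.mem_union_left _ (hα a ha)))
      (Finset.mem_union_right _ (Finset.mem_insert_self v P.exis))
      (vars_clauseFormula_subset fun y hy => hsub (hY y hy)))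
  | red0 P Γ L u hL | red1 P Γ L u hL => exact hst ((vars_replace_subset rfl).trans (hs L hL))
  | weakenExists | weakenForall => exact fun A hA => (hs A hA).trans hsub

theorem Derives.vars_subset (h : Derives F Q n s) :
    Q.pre.vars ⊆ s.pre.vars ∧ ∀ L ∈ s.lines, L.vars ⊆ s.pre.vars := by
  induction h with
  | start => simp
  | step _ hstep ih =>
    refine ⟨ih.1.trans hstep.vars_pre_subset, hstep.vars_lines_subset ?_ ih.2⟩
    rintro _ ⟨K, hK, rfl⟩
    exact vars_clauseFormula_subset fun l hl => ih.1 (Q.closed K hK l hl)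

theorem DerivesWithin.vars_subset (h : DerivesWithin F Q n s) (hL : L ∈ s.lines) :
    L.vars ⊆ s.pre.vars :=
  let ⟨_, _, h⟩ := h
  h.vars_subset.2 L hL

/-- From every derivable stage extending `s`, at most `k` further rule applications lead to an
extension with the property `R`. Quantifying over the extensions of `s` makes it possible to
compose such claims in any order. -/
def Attains (F : FregeSystem) (Q : DQBF) (k : ℕ) (s : Stage) (R : Stage → Prop) : Prop :=
  ∀ n t, s ≤ t → DerivesWithin F Q n t → ∃ t', t ≤ t' ∧ DerivesWithin F Q (n + k) t' ∧ R t'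

namespace Attains

theorem of_le (h : ∀ t, s ≤ t → R t) : Attains F Q 0 s R :=
  fun _ t hst ht => ⟨t, le_rfl, ht, h t hst⟩

theorem mono (h : Attains F Q k s R) (hst : s ≤ t) : Attains F Q k t R :=
  fun n t' ht => h n t' (hst.trans ht)

theorem le (h : Attains F Q k s R) (hkl : k ≤ l) : Attains F Q l s R := by
  intro n t hst ht
  obtain ⟨t', htt', ⟨m, hm, ht'⟩, hR⟩ := h n t hst ht
  exact ⟨t', htt', ⟨m, by omega, ht'⟩, hR⟩

theorem bind (h : Attains F Q k s R) (h' : ∀ t, s ≤ t → R t → Attains F Q l t R') :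
    Attains F Q (k + l) s R' := by
  intro n t hst ht
  obtain ⟨t₁, htt₁, ht₁, hR⟩ := h n t hst ht
  obtain ⟨t₂, ht₁₂, ht₂, hR'⟩ := h' t₁ (hst.trans htt₁) hR _ _ le_rfl ht₁
  exact ⟨t₂, htt₁.trans ht₁₂, by rwa [← add_assoc], hR'⟩

theorem map (h : Attains F Q k s R) (h' : ∀ t, s ≤ t → R t → R' t) : Attains F Q k s R' := by
  intro n t hst ht
  obtain ⟨t', htt', ht', hR⟩ := h n t hst ht
  exact ⟨t', htt', ht', h' t' (hst.trans htt') hR⟩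

theorem of_step (h : ∀ t, s ≤ t → ∃ t',
    Step F {L | ∃ K ∈ Q.matrix, L = clauseFormula K} t t' ∧ t ≤ t' ∧ R t') :
    Attains F Q 1 s R := by
  rintro n t hst ⟨m, hm, ht⟩
  obtain ⟨t', hstep, htt', hR⟩ := h t hst
  exact ⟨t', htt', ⟨m + 1, by omega, ht.step hstep⟩, hR⟩

theorem forall_finset {ι : Type*} {I : Finset ι} {A : ι → Formula}
    (h : ∀ i ∈ I, Attains F Q k s (A i ∈ ·.lines)) :
    Attains F Q (I.card * k) s fun t => ∀ i ∈ I, A i ∈ t.lines := by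
  classical
  induction I using Finset.induction_on with
  | empty => exact (of_le (by simp)).le (Nat.zero_le _)
  | insert i I hi ih =>
    rw [Finset.card_insert_of_notMem hi, add_mul, one_mul]
    refine (ih fun j hj => h j (by simp [hj])).bind fun t hst ht => ?_
    exact ((h i (by simp)).mono hst).map fun t' htt' ht' => by
      simpa using ⟨ht', fun j hj => htt'.2 (ht j hj)⟩

open DepPrefix in
theorem exists_newVars {ι : Type*} {I : Finset ι} {D : ι → Finset ℕ}
    {A : ι → ℕ → Formula} (f₀ : ι → ℕ)
    (h : ∀ i ∈ I, ∀ t, s ≤ t → Attains F Q k t fun t' =>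
      ∃ v, IsNewVar t.pre t'.pre v (D i) ∧ A i v ∈ t'.lines) :
    Attains F Q (I.card * k) s fun t => ∃ f : ι → ℕ, Set.InjOn f I ∧ (∀ i ∉ I, f i = f₀ i) ∧
      ∀ i ∈ I, IsNewVar s.pre t.pre (f i) (D i) ∧ A i (f i) ∈ t.lines := by
  classical
  induction I using Finset.induction_on with
  | empty => exact (of_le fun t _ => ⟨f₀, by simp⟩).le (Nat.zero_le _)
  | insert i I hi ih =>
    rw [Finset.card_insert_of_notMem hi, add_mul, one_mul]
    refine (ih fun j hj => h j (by simp [hj])).bind fun t hst ⟨f, hf, hf₀, hfI⟩ => ?_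
    refine (h i (by simp) t hst).map fun t' htt' ⟨v, hv, hA⟩ =>
      ⟨Function.update f i v, ?_, ?_, ?_⟩
    · have hupdate : Set.EqOn f (Function.update f i v) I := fun j hj =>
        (Function.update_of_ne (ne_of_mem_of_not_mem hj hi) _ _).symm
      rw [Finset.coe_insert, Set.injOn_insert (by simpa using hi)]
      refine ⟨hf.congr hupdate, ?_⟩
      rintro ⟨j, hj, hjv⟩
      rw [← hupdate hj, Function.update_self] at hjv
      exact hv.notMem_vars (hjv ▸ Finset.mem_union_right _ (hfI j hj).1.mem_exis)
    · intro j hj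
      rw [Finset.mem_insert, not_or] at hj
      rw [Function.update_of_ne hj.1, hf₀ j hj.2]
    · refine Finset.forall_mem_insert _ _ _ |>.2 ⟨?_, fun j hj => ?_⟩
      · rw [Function.update_self]
        exact ⟨hv.mono hst.1, hA⟩
      · rw [Function.update_of_ne (ne_of_mem_of_not_mem hj hi)]
        exact ⟨(hfI j hj).1.trans_le htt'.1, htt'.2 (hfI j hj).2⟩

theorem axiom_clause {K : Clause} (hK : K ∈ Q.matrix) :
    Attains F Q 1 s (clauseFormula K ∈ ·.lines) :=
  of_step fun t _ => ⟨_, .ax t.pre t.lines (clauseFormula K) ⟨K, hK, rfl⟩,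
    ⟨le_rfl, List.subset_cons_self _ _⟩, List.mem_cons_self⟩

theorem frege_rule {r : FregeRule} {σ : ℕ → Formula} (hr : r ∈ F.rules)
    (hprem : ∀ A ∈ r.premises, A.subst σ ∈ s.lines)
    (hvars : (r.conclusion.subst σ).vars ⊆ s.pre.vars) :
    Attains F Q 1 s (r.conclusion.subst σ ∈ ·.lines) :=
  of_step fun t hst => ⟨_, .frege t.pre t.lines r σ hr (fun A hA => hst.2 (hprem A hA))
      (hvars.trans (DepPrefix.vars_subset_of_le hst.1)),
    ⟨le_rfl, List.subset_cons_self _ _⟩, List.mem_cons_self⟩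

open DepPrefix in
theorem ext_conj {α Y : Finset Literal} {D : Finset ℕ} (hα : ∀ a ∈ α, a.var ∈ s.pre.univ)
    (hY : ∀ y ∈ Y, y.var ∈ s.pre.varsWithin (D ∪ α.image Literal.var)) :
    Attains F Q 1 s fun t => ∃ v, IsNewVar s.pre t.pre v D ∧
      imp (conjFormula α) (iff (var v) (conjFormula Y)) ∈ t.lines :=
  of_step fun t hst => by
    obtain ⟨v, hv⟩ := Infinite.exists_notMem_finset t.pre.vars
    have hY' (y) (hy : y ∈ Y) := varsWithin_subset_of_le hst.1 (hY y hy)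
    have hYvars (y) (hy : y ∈ Y) := varsWithin_subset_vars (hY' y hy)
    have hdep := t.pre.extDep_subset α Y hYvars
    exact ⟨_, .indExtAnd t.pre t.lines α Y v (fun a ha => (univ_eq_of_le hst.1).symm ▸ hα a ha)
        hYvars hv,
      ⟨le_addExists hv hdep, List.subset_cons_self _ _⟩, v,
      (isNewVar_addExists hv hdep (extDep_subset_of_varsWithin hY')).mono hst.1,
      List.mem_cons_self⟩

open DepPrefix in
theorem ext_clause {α Y : Finset Literal} {D : Finset ℕ} (hα : ∀ a ∈ α, a.var ∈ s.pre.univ)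
    (hY : ∀ y ∈ Y, y.var ∈ s.pre.varsWithin (D ∪ α.image Literal.var)) :
    Attains F Q 1 s fun t => ∃ v, IsNewVar s.pre t.pre v D ∧
      imp (conjFormula α) (iff (var v) (clauseFormula Y)) ∈ t.lines :=
  of_step fun t hst => by
    obtain ⟨v, hv⟩ := Infinite.exists_notMem_finset t.pre.vars
    have hY' (y) (hy : y ∈ Y) := varsWithin_subset_of_le hst.1 (hY y hy)
    have hYvars (y) (hy : y ∈ Y) := varsWithin_subset_vars (hY' y hy)
    have hdep := t.pre.extDep_subset α Y hYvars
    exact ⟨_, .indExtOr t.pre t.lines α Y v (fun a ha => (univ_eq_of_le hst.1).symm ▸ hα a ha)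
        hYvars hv,
      ⟨le_addExists hv hdep, List.subset_cons_self _ _⟩, v,
      (isNewVar_addExists hv hdep (extDep_subset_of_varsWithin hY')).mono hst.1,
      List.mem_cons_self⟩

open DepPrefix in
theorem reduce {u : ℕ} (hL : L ∈ s.lines) (hu : u ∈ s.pre.univ)
    (hvars : L.vars ⊆ insert u (s.pre.varsWithin (s.pre.univ.erase u))) (b : Bool) :
    Attains F Q 1 s (L.replace u (if b then tru else fls) ∈ ·.lines) :=
  of_step fun t hst => by
    have hut : u ∈ t.pre.univ := (univ_eq_of_le hst.1).symm ▸ hu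
    have hdep : ∀ x ∈ L.vars, x ∈ t.pre.exis → u ∉ t.pre.dep x := by
      intro x hx hxt
      rcases Finset.mem_insert.1 (hvars hx) with rfl | hx
      · exact absurd hxt (notMem_exis_of_mem_univ hut)
      · rw [← depSet_of_mem_exis hxt]
        exact fun h => Finset.notMem_erase u _
          ((Finset.mem_filter.1 (varsWithin_subset_of_le hst.1 hx)).2 h)
    cases b
    · exact ⟨_, .red0 t.pre t.lines L u (hst.2 hL) hut hdep,
        ⟨le_rfl, List.subset_cons_self _ _⟩, List.mem_cons_self⟩
    · exact ⟨_, .red1 t.pre t.lines L u (hst.2 hL) hut hdep,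
        ⟨le_rfl, List.subset_cons_self _ _⟩, List.mem_cons_self⟩

end Attains

/-- `N` rule applications of dFrege+∀red over `F` simulate one inference of `Prov`, as long as
only quantified variables are substituted. -/
def Simulates (F : FregeSystem) (N : ℕ) : Prop :=
  ∀ (Q : DQBF) (s : Stage) (r : FregeRule) (σ : ℕ → Formula), r.IsSound → r.weight ≤ 100 →
    (∀ x, (σ x).vars ⊆ s.pre.vars) → (∀ A ∈ r.premises, A.subst σ ∈ s.lines) →
    Attains F Q N s (r.conclusion.subst σ ∈ ·.lines)

theorem FregeDerivable.exists_attains {G : List Formula} {B : Formula}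
    (h : FregeDerivable F.rules G B) :
    ∃ N, ∀ (Q : DQBF) (s : Stage) (σ : ℕ → Formula), (∀ x, (σ x).vars ⊆ s.pre.vars) →
      (∀ A ∈ G, A.subst σ ∈ s.lines) → Attains F Q N s (B.subst σ ∈ ·.lines) := by
  classical
  induction h with
  | hyp hA => exact ⟨0, fun Q s σ _ hG => .of_le fun t hst => hst.2 (hG _ hA)⟩
  | @rule r τ hr _ ih =>
    choose! N hN using ih
    set I := r.premises.toFinset
    refine ⟨I.card * I.sup N + 1, fun Q s σ hσ hG => ?_⟩
    have premises : Attains F Q (I.card * I.sup N) s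
        fun t => ∀ A ∈ I, (A.subst τ).subst σ ∈ t.lines :=
      .forall_finset fun A hA =>
        (hN A (List.mem_toFinset.1 hA) Q s σ hσ hG).le (Finset.le_sup hA)
    refine premises.bind fun t hst ht => ?_
    rw [subst_subst]
    refine .frege_rule hr (fun A hA => ?_) (vars_subst_subset fun x _ => ?_)
    · rw [← subst_subst]
      exact ht A (List.mem_toFinset.2 hA)
    · exact vars_subst_subset fun y _ => (hσ y).trans (DepPrefix.vars_subset_of_le hst.1)

theorem exists_simulates (F : FregeSystem) : ∃ N, Simulates F N := by
  have bound (r : FregeRule) (hr : r.IsSound) :=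
    (F.complete r.premises r.conclusion hr).exists_attains
  choose! N hN using bound
  refine ⟨(FregeRule.finite_weight_le 100).toFinset.sup N, fun Q s r σ hr hw hσ hprem => ?_⟩
  exact (hN r hr Q s σ hσ hprem).le (Finset.le_sup (by simpa using hw))

namespace Simulates

variable {N : ℕ} (hF : Simulates F N)
include hF

theorem attains_subst_of_prov {Γ : Set Formula} {A : Formula} {σ : ℕ → Formula} (h : Prov Γ n A)
    (hσ : ∀ x, (σ x).vars ⊆ s.pre.vars) (hΓ : ∀ G ∈ Γ, G.subst σ ∈ s.lines) :
    Attains F Q (N * n) s (A.subst σ ∈ ·.lines) := by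
  induction h generalizing s with
  | hyp hA => exact (Attains.of_le fun t hst => hst.2 (hΓ _ hA)).le (Nat.zero_le _)
  | cut _ _ ih ih' =>
    rw [mul_add]
    refine (ih hσ hΓ).bind fun t hst ht => ih' (fun x => ?_) ?_
    · exact (hσ x).trans (DepPrefix.vars_subset_of_le hst.1)
    · exact Set.forall_mem_insert.2 ⟨ht, fun G hG => hst.2 (hΓ G hG)⟩
  | rule τ hr hw hprem =>
    rw [mul_one, subst_subst]
    refine hF Q s _ _ hr hw (fun x => vars_subst_subset fun y _ => hσ y) fun A hA => ?_
    rw [← subst_subst]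
    exact hΓ _ (hprem A hA)

theorem attains_of_prov {A : Formula} (h : Prov {L | L ∈ s.lines} n A) (hA : A.vars ⊆ s.pre.vars) :
    Attains F Q (N * n) s (A ∈ ·.lines) := by
  intro k t hst ht
  -- Variables that are not quantified may occur inside the proof `h`; they are replaced by `1`.
  set σ : ℕ → Formula := fun x => if x ∈ t.pre.vars then var x else tru
  have hσ : ∀ x, (σ x).vars ⊆ t.pre.vars := by
    intro x
    by_cases hx : x ∈ t.pre.vars <;> simp [σ, hx, vars]
  have subst_σ {L : Formula} (hL : L.vars ⊆ t.pre.vars) : L.subst σ = L :=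
    subst_eq_self fun x hx => if_pos (hL hx)
  have hlines : ∀ L ∈ {L | L ∈ s.lines}, L.subst σ ∈ t.lines := by
    intro L hL
    rw [subst_σ (ht.vars_subset (hst.2 hL))]
    exact hst.2 hL
  have := hF.attains_subst_of_prov (Q := Q) h hσ hlines
  rw [subst_σ (hA.trans (DepPrefix.vars_subset_of_le hst.1))] at this
  exact this k t le_rfl ht

/-! ### Variables with a given definition -/

section Definitions

open DepPrefix (IsNewVar varsWithin_subset_vars vars_subset_of_le varsWithin_subset_of_le)

theorem exists_iff_of_ext {D : Finset ℕ} {A B : Formula}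
    (h : Attains F Q 1 s fun t => ∃ v, IsNewVar s.pre t.pre v D ∧
      imp (conjFormula ∅) (iff (var v) A) ∈ t.lines)
    (hAB : Prov ∅ n (iff A B)) (hB : B.vars ⊆ s.pre.vars) :
    Attains F Q (1 + N * (n + 1)) s fun t => ∃ v, IsNewVar s.pre t.pre v D ∧
      iff (var v) B ∈ t.lines := by
  refine h.bind fun t hst ⟨v, hv, hline⟩ =>
    (hF.attains_of_prov ?_ ?_).map fun t' htt' ht' => ⟨v, hv.trans_le htt'.1, ht'⟩
  · replace hline : imp tru (iff (var v) A) ∈ t.lines := by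
      simpa [conjFormula, bigAnd] using hline
    exact (Prov.rule₂ [var v, A, B] (imp tru (iff (var 0) (var 1))) (iff (var 1) (var 2))
      (iff (var 0) (var 2)) (.hyp (n := 0) hline) (hAB.mono (Set.empty_subset _))).le (by omega)
  · have hvt : v ∈ t.pre.vars := Finset.mem_union_right _ hv.mem_exis
    simpa [Formula.vars, Finset.insert_subset_iff, hvt] using hB.trans (vars_subset_of_le hst.1)

theorem exists_iff_conjFormula {Y : Finset Literal} {D : Finset ℕ}
    (hY : ∀ y ∈ Y, y.var ∈ s.pre.varsWithin D) :
    Attains F Q (1 + N * 2) s fun t => ∃ v, IsNewVar s.pre t.pre v D ∧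
      iff (var v) (conjFormula Y) ∈ t.lines :=
  hF.exists_iff_of_ext (n := 1) (.ext_conj (by simp) (by simpa using hY))
    (Prov.rule₀ [conjFormula Y] (iff (var 0) (var 0)))
    (vars_conjFormula_subset fun y hy => varsWithin_subset_vars (hY y hy))

theorem exists_iff_clauseFormula {Y : Finset Literal} {D : Finset ℕ}
    (hY : ∀ y ∈ Y, y.var ∈ s.pre.varsWithin D) :
    Attains F Q (1 + N * 2) s fun t => ∃ v, IsNewVar s.pre t.pre v D ∧
      iff (var v) (clauseFormula Y) ∈ t.lines :=
  hF.exists_iff_of_ext (n := 1) (.ext_clause (by simp) (by simpa using hY))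
    (Prov.rule₀ [clauseFormula Y] (iff (var 0) (var 0)))
    (vars_clauseFormula_subset fun y hy => varsWithin_subset_vars (hY y hy))

theorem exists_iff_and {a b : Literal} {D : Finset ℕ} (ha : a.var ∈ s.pre.varsWithin D)
    (hb : b.var ∈ s.pre.varsWithin D) :
    Attains F Q (1 + N * 11) s fun t => ∃ v, IsNewVar s.pre t.pre v D ∧
      iff (var v) (and a.toFormula b.toFormula) ∈ t.lines :=
  hF.exists_iff_of_ext (.ext_conj (Y := {a, b}) (by simp) (by simp [ha, hb]))
    (Prov.conjFormula_pair_iff a b) (by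
      simp [Formula.vars, Finset.insert_subset_iff, varsWithin_subset_vars ha,
        varsWithin_subset_vars hb])

theorem exists_iff_or {a b : Literal} {D : Finset ℕ} (ha : a.var ∈ s.pre.varsWithin D)
    (hb : b.var ∈ s.pre.varsWithin D) :
    Attains F Q (1 + N * 11) s fun t => ∃ v, IsNewVar s.pre t.pre v D ∧
      iff (var v) (or a.toFormula b.toFormula) ∈ t.lines :=
  hF.exists_iff_of_ext (.ext_clause (Y := {a, b}) (by simp) (by simp [ha, hb]))
    (Prov.clauseFormula_pair_iff a b) (by
      simp [Formula.vars, Finset.insert_subset_iff, varsWithin_subset_vars ha,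
        varsWithin_subset_vars hb])

/-- The new variable equals `x` if `w` is false, and `(x ∨ l₁) ∧ l₂` if `w` is true. -/
theorem exists_switched_copy {w x : ℕ} {l₁ l₂ : Literal} {D : Finset ℕ}
    (hw : w ∈ s.pre.varsWithin D) (hx : x ∈ s.pre.varsWithin D) (hl₁ : l₁.var ∈ s.pre.varsWithin D)
    (hl₂ : l₂.var ∈ s.pre.varsWithin D) :
    Attains F Q (4 + N * 46) s fun t => ∃ v, IsNewVar s.pre t.pre v D ∧
      iff (var v) (and (or (var x) (and (var w) l₁.toFormula)) (or (neg (var w)) l₂.toFormula)) ∈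
        t.lines := by
  have gates : Attains F Q (4 * (1 + N * 11)) s fun t => ∃ a b c v, IsNewVar s.pre t.pre v D ∧
      iff (var a) (and (var w) l₁.toFormula) ∈ t.lines ∧
      iff (var b) (or (var x) (var a)) ∈ t.lines ∧
      iff (var c) (or (neg (var w)) l₂.toFormula) ∈ t.lines ∧
      iff (var v) (and (var b) (var c)) ∈ t.lines := by
    refine ((hF.exists_iff_and (a := ⟨w, true⟩) hw hl₁).bind fun t₁ h₁ ⟨a, ha, hla⟩ =>
      (hF.exists_iff_or (a := ⟨x, true⟩) (b := ⟨a, true⟩) (varsWithin_subset_of_le h₁.1 hx)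
        ha.mem_varsWithin).bind fun t₂ h₂ ⟨b, hb, hlb⟩ =>
      (hF.exists_iff_or (a := ⟨w, false⟩) (varsWithin_subset_of_le (h₁.trans h₂).1 hw)
        (varsWithin_subset_of_le (h₁.trans h₂).1 hl₂)).bind fun t₃ h₃ ⟨c, hc, hlc⟩ =>
      (hF.exists_iff_and (a := ⟨b, true⟩) (b := ⟨c, true⟩)
        (varsWithin_subset_of_le h₃.1 hb.mem_varsWithin) hc.mem_varsWithin).map
        fun t₄ h₄ ⟨v, hv, hlv⟩ => ?_).le (by omega)
    exact ⟨a, b, c, v, hv.mono (h₁.trans (h₂.trans h₃)).1, (h₂.trans (h₃.trans h₄)).2 hla,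
      (h₃.trans h₄).2 hlb, h₄.2 hlc, hlv⟩
  refine (gates.bind fun t hst ⟨a, b, c, v, hv, hla, hlb, hlc, hlv⟩ =>
    (hF.attains_of_prov ?_ ?_).map fun t' htt' ht' => ⟨v, hv.trans_le htt'.1, ht'⟩).le
    (l := 4 + N * 46) (k := 4 * (1 + N * 11) + N * 2) (by omega)
  · have hb : Prov {L | L ∈ t.lines} 1 (iff (var b) (or (var x) (and (var w) l₁.toFormula))) :=
      Prov.rule₂ [var a, var b, and (var w) l₁.toFormula, var x] (iff (var 0) (var 2))
        (iff (var 1) (or (var 3) (var 0))) (iff (var 1) (or (var 3) (var 2)))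
        (.hyp (n := 0) hla) (.hyp (n := 0) hlb)
    exact Prov.rule₃ [var b, var c, var v, or (var x) (and (var w) l₁.toFormula),
        or (neg (var w)) l₂.toFormula] (iff (var 0) (var 3)) (iff (var 1) (var 4))
      (iff (var 2) (and (var 0) (var 1))) (iff (var 2) (and (var 3) (var 4)))
      hb (.hyp (n := 0) hlc) (.hyp (n := 0) hlv)
  · have hvt : v ∈ t.pre.vars := Finset.mem_union_right _ hv.mem_exis
    have hvars (y) (hy : y ∈ s.pre.varsWithin D) :=
      vars_subset_of_le hst.1 (varsWithin_subset_vars hy)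
    simp [Formula.vars, Finset.insert_subset_iff, hvt, hvars _ hw, hvars _ hx, hvars _ hl₁,
      hvars _ hl₂]

theorem attains_of_or_universal {u : Literal} {A : Formula} (hL : or u.toFormula A ∈ s.lines)
    (hu : u.var ∈ s.pre.univ) (hA : A.vars ⊆ s.pre.varsWithin (s.pre.univ.erase u.var)) :
    Attains F Q (1 + N * 1) s (A ∈ ·.lines) := by
  have hA' (x) (hx : x ∈ A.vars) : x ≠ u.var := by
    rintro rfl
    have := (Finset.mem_filter.1 (hA hx)).2
    simp [DepPrefix.depSet_of_mem_univ hu] at this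
  have hreplace (b : Formula) :
      (or u.toFormula A).replace u.var b = or (u.toFormula.replace u.var b) A :=
    congrArg (Formula.or _) (subst_eq_self fun x hx => Function.update_of_ne (hA' x hx) _ _)
  refine (Attains.reduce hL hu ?_ !u.pos).bind fun t hst ht => hF.attains_of_prov ?_
    ((hA.trans varsWithin_subset_vars).trans (vars_subset_of_le hst.1))
  · simpa [Formula.vars] using Finset.insert_subset_insert _ hA
  · rw [hreplace] at ht
    obtain ⟨x, _ | _⟩ := u
    · refine Prov.rule₁ [A] (or (neg tru) (var 0)) (var 0) (.hyp (n := 0) ?_)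
      simpa [Formula.replace, Formula.subst, Literal.toFormula] using ht
    · refine Prov.rule₁ [A] (or fls (var 0)) (var 0) (.hyp (n := 0) ?_)
      simpa [Formula.replace, Formula.subst, Literal.toFormula] using ht

end Definitions

end Simulates

/-! ### Copies of clauses -/

namespace DepPrefix

variable {P : DepPrefix} {u : ℕ} {D : Clause} {k : Literal}

theorem notMem_dependents_of_mem_univ {x : ℕ} (hx : x ∈ P.univ) : x ∉ P.dependents u := fun h =>
  notMem_exis_of_mem_univ hx (Finset.mem_filter.1 h).1

theorem outerClause_subset : P.outerClause u D ⊆ D := Finset.filter_subset _ _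

theorem mem_varsWithin_of_mem_outerClause (hk : k ∈ P.outerClause u D) :
    k.var ∈ P.varsWithin (P.commonDeps u) := by
  rcases (Finset.mem_filter.1 hk).2 with h | h
  · exact mem_varsWithin_of_mem_exis h.1 h.2
  · exact mem_varsWithin_of_mem_univ h.1 h.2

theorem notMem_depSet_of_mem_outerClause (hk : k ∈ P.outerClause u D) : u ∉ P.depSet k.var := by
  intro h
  have := (Finset.mem_filter.1 (mem_varsWithin_of_mem_outerClause hk)).2 h
  exact (Finset.mem_filter.1 this).2.1 rfl

theorem notMem_dependents_of_mem_outerClause (hk : k ∈ P.outerClause u D) :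
    k.var ∉ P.dependents u := by
  intro h
  obtain ⟨hexis, hdep⟩ := Finset.mem_filter.1 h
  exact notMem_depSet_of_mem_outerClause hk (by rwa [depSet_of_mem_exis hexis])

theorem var_ne_of_mem_outerClause (hu : u ∈ P.univ) (hk : k ∈ P.outerClause u D) :
    k.var ≠ u := by
  rintro rfl
  exact notMem_depSet_of_mem_outerClause hk (by simp [depSet_of_mem_univ hu])

end DepPrefix

section Copies

theorem Literal.neg_ne (l : Literal) : l.neg ≠ l := by
  cases l
  simp [Literal.neg]

/-- The literal `l` of the copy along `ρ`, as in `renameClause`. -/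
def Literal.rename (ρ : ℕ → ℕ) (l : Literal) : Literal := ⟨ρ l.var, l.pos⟩

theorem Literal.rename_eq_self {ρ : ℕ → ℕ} {l : Literal} (h : ρ l.var = l.var) :
    l.rename ρ = l := by
  simp [rename, h]

theorem rename_mem_renameClause {ρ : ℕ → ℕ} {K : Clause} {l : Literal} (h : l ∈ K) :
    l.rename ρ ∈ renameClause ρ K :=
  Finset.mem_image_of_mem _ h

theorem card_renameClause_le {ρ : ℕ → ℕ} {K : Clause} : (renameClause ρ K).card ≤ K.card :=
  Finset.card_image_le

theorem Prov.renameClause_imp {f : ℕ → ℕ} {K : Clause} {b : ℕ} (hK : K.card ≤ b)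
    (h : ∀ l ∈ K, Prov Γ n (imp (l.rename f).toFormula A)) :
    Prov Γ (b * (n + 1) + 1) (imp (clauseFormula (renameClause f K)) A) :=
  (Prov.clauseFormula_imp (Finset.forall_mem_image.2 h)).le
    (by gcongr; exact card_renameClause_le.trans hK)

theorem Prov.imp_renameClause {ρ : ℕ → ℕ} {K : Clause} {l : Literal} {b : ℕ} (hK : K.card ≤ b)
    (hl : l ∈ K) : Prov Γ b (imp (l.rename ρ).toFormula (clauseFormula (renameClause ρ K))) :=
  (Prov.imp_clauseFormula (rename_mem_renameClause hl)).le (card_renameClause_le.trans hK)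

namespace DQBF

/-- The path literals from the clause `C ∨ u`. -/
def IsPathLit (Q : DQBF) (C : Clause) (u : Literal) : Literal → Prop :=
  PathLit Q.matrix {insert u C} (Q.pre.dependents u.var)

/-- The clauses that are reachable from the clause `C ∨ u`. -/
def IsReachable (Q : DQBF) (C : Clause) (u : Literal) : Clause → Prop :=
  PathClause Q.matrix {insert u C} (Q.pre.dependents u.var)

open Classical in
/-- The lower bound for the copy of `x` while the switch `w` is on: `f x` if `x` is a path literal,
and otherwise `¬w`, which stands for the constant `0` since `w` is true. -/
noncomputable def joinLiteral (Q : DQBF) (C : Clause) (u : Literal) (w : ℕ) (f : ℕ → ℕ) (x : ℕ) :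
    Literal :=
  if Q.IsPathLit C u ⟨x, true⟩ then ⟨f x, true⟩ else ⟨w, false⟩

open Classical in
/-- The upper bound for the copy of `x` while the switch `w` is on: `f x` if `x̄` is a path literal,
and otherwise `w`, which stands for the constant `1`. -/
noncomputable def meetLiteral (Q : DQBF) (C : Clause) (u : Literal) (w : ℕ) (f : ℕ → ℕ) (x : ℕ) :
    Literal :=
  if Q.IsPathLit C u ⟨x, false⟩ then ⟨f x, true⟩ else ⟨w, true⟩

/-- In the presence of the lines `Γ`, the variable `w` switches between the two cases of the
argument: if `w` is true, then so are `u` and the outer clauses of all reachable clauses with the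
literal `ū`, and if `w` is false, then `C` is true. These facts have proofs of length `m`. -/
structure IsSwitch (Q : DQBF) (C : Clause) (u : Literal) (Γ : Set Formula) (m w : ℕ) : Prop where
  pivot : Prov Γ m (imp (var w) u.toFormula)
  outer : ∀ D, Q.IsReachable C u D → u.neg ∈ D →
    Prov Γ m (imp (var w) (clauseFormula (Q.pre.outerClause u.var D)))
  clause : Prov Γ m (imp (neg (var w)) (clauseFormula C))

/-- The lines `Γ` contain the clauses of the matrix, the restriction of each clause to the values
`f x` that the variables `x ∈ 𝒮` take when `u` is false, and the definitions of the copies `ρ x`. -/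
structure IsCopy (Q : DQBF) (C : Clause) (u : Literal) (Γ : Set Formula) (w : ℕ)
    (f ρ : ℕ → ℕ) : Prop where
  matrix_subset : ∀ K ∈ Q.matrix, clauseFormula K ∈ Γ
  restricted_mem : ∀ K ∈ Q.matrix, u.neg ∉ K →
    clauseFormula (renameClause f (K.erase u)) ∈ Γ
  restriction_eq : ∀ x ∉ Q.pre.dependents u.var, f x = x
  copy_eq : ∀ x ∉ Q.pre.dependents u.var, ρ x = x
  copy_iff_mem : ∀ x ∈ Q.pre.dependents u.var,
    iff (var (ρ x)) (and (or (var x) (and (var w) (Q.joinLiteral C u w f x).toFormula))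
      (or (neg (var w)) (Q.meetLiteral C u w f x).toFormula)) ∈ Γ

theorem imp_meetLiteral {C : Clause} {u : Literal} {w : ℕ} {f : ℕ → ℕ} (x : ℕ) :
    Prov Γ 1 (imp (var (f x)) (imp (var w) (Q.meetLiteral C u w f x).toFormula)) := by
  rw [meetLiteral]
  split_ifs
  · exact Prov.rule₀ [var (f x), var w] (imp (var 0) (imp (var 1) (var 0)))
  · exact Prov.rule₀ [var (f x), var w] (imp (var 0) (imp (var 1) (var 1)))

theorem joinLiteral_imp {C : Clause} {u : Literal} {w : ℕ} {f : ℕ → ℕ} (x : ℕ) :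
    Prov Γ 1 (imp (Q.joinLiteral C u w f x).toFormula (imp (var w) (var (f x)))) := by
  rw [joinLiteral]
  split_ifs
  · exact Prov.rule₀ [var (f x), var w] (imp (var 0) (imp (var 1) (var 0)))
  · exact Prov.rule₀ [var (f x), var w] (imp (neg (var 1)) (imp (var 1) (var 0)))

namespace IsCopy

variable {C K : Clause} {u : Literal} {w : ℕ} {f ρ : ℕ → ℕ} {l : Literal} {b : ℕ}
  (h : Q.IsCopy C u Γ w f ρ)
include h

theorem imp_off_rename (l : Literal) :
    Prov Γ 1 (imp l.toFormula (imp (neg (var w)) (l.rename ρ).toFormula)) := by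
  by_cases hl : l.var ∈ Q.pre.dependents u.var
  · have hdef := Prov.hyp (n := 0) (h.copy_iff_mem _ hl)
    obtain ⟨x, _ | _⟩ := l
    · exact Prov.rule₁ [var w, var x, var (ρ x), _, _]
        (iff (var 2) (and (or (var 1) (and (var 0) (var 3))) (or (neg (var 0)) (var 4))))
        (imp (neg (var 1)) (imp (neg (var 0)) (neg (var 2)))) hdef
    · exact Prov.rule₁ [var w, var x, var (ρ x), _, _]
        (iff (var 2) (and (or (var 1) (and (var 0) (var 3))) (or (neg (var 0)) (var 4))))
        (imp (var 1) (imp (neg (var 0)) (var 2))) hdef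
  · rw [Literal.rename_eq_self (h.copy_eq _ hl)]
    exact Prov.rule₀ [l.toFormula, var w] (imp (var 0) (imp (neg (var 1)) (var 0)))

theorem imp_on_rename (hl : ¬ Q.IsPathLit C u l.neg) :
    Prov Γ 1 (imp l.toFormula (imp (var w) (l.rename ρ).toFormula)) := by
  by_cases hlS : l.var ∈ Q.pre.dependents u.var
  · have hdef := h.copy_iff_mem _ hlS
    obtain ⟨x, _ | _⟩ := l
    · have hjoin : Q.joinLiteral C u w f x = ⟨w, false⟩ := if_neg hl
      rw [hjoin] at hdef
      exact Prov.rule₁ [var w, var x, var (ρ x), _]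
        (iff (var 2) (and (or (var 1) (and (var 0) (neg (var 0)))) (or (neg (var 0)) (var 3))))
        (imp (neg (var 1)) (imp (var 0) (neg (var 2)))) (.hyp (n := 0) hdef)
    · have hmeet : Q.meetLiteral C u w f x = ⟨w, true⟩ := if_neg hl
      rw [hmeet] at hdef
      exact Prov.rule₁ [var w, var x, var (ρ x), _]
        (iff (var 2) (and (or (var 1) (and (var 0) (var 3))) (or (neg (var 0)) (var 0))))
        (imp (var 1) (imp (var 0) (var 2))) (.hyp (n := 0) hdef)
  · rw [Literal.rename_eq_self (h.copy_eq _ hlS)]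
    exact Prov.rule₀ [l.toFormula, var w] (imp (var 0) (imp (var 1) (var 0)))

theorem restricted_imp_on_rename (hl : Q.IsPathLit C u l ∨ l.var ∉ Q.pre.dependents u.var) :
    Prov Γ 2 (imp (l.rename f).toFormula (imp (var w) (l.rename ρ).toFormula)) := by
  by_cases hlS : l.var ∈ Q.pre.dependents u.var
  · replace hl := hl.resolve_right (not_not_intro hlS)
    have hdef := h.copy_iff_mem _ hlS
    obtain ⟨x, _ | _⟩ := l
    · have hmeet : Q.meetLiteral C u w f x = ⟨f x, true⟩ := if_pos hl
      rw [hmeet] at hdef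
      exact Prov.rule₁ [var w, var x, var (ρ x), _, var (f x)]
        (iff (var 2) (and (or (var 1) (and (var 0) (var 3))) (or (neg (var 0)) (var 4))))
        (imp (neg (var 4)) (imp (var 0) (neg (var 2)))) (.hyp (n := 1) hdef)
    · have hjoin : Q.joinLiteral C u w f x = ⟨f x, true⟩ := if_pos hl
      rw [hjoin] at hdef
      exact Prov.rule₂ [var w, var x, var (ρ x), var (f x), _]
        (iff (var 2) (and (or (var 1) (and (var 0) (var 3))) (or (neg (var 0)) (var 4))))
        (imp (var 3) (imp (var 0) (var 4))) (imp (var 3) (imp (var 0) (var 2)))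
        (.hyp (n := 0) hdef) (imp_meetLiteral x)
  · rw [Literal.rename_eq_self (h.copy_eq _ hlS), Literal.rename_eq_self (h.restriction_eq _ hlS)]
    exact (Prov.rule₀ [l.toFormula, var w] (imp (var 0) (imp (var 1) (var 0)))).le one_le_two

theorem imp_restricted_imp_on_rename (hlS : l.var ∈ Q.pre.dependents u.var) :
    Prov Γ 2 (imp (l.rename f).toFormula
      (imp l.toFormula (imp (var w) (l.rename ρ).toFormula))) := by
  have hdef := Prov.hyp (n := 0) (h.copy_iff_mem _ hlS)
  obtain ⟨x, _ | _⟩ := l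
  · exact Prov.rule₂ [var w, var x, var (ρ x), var (f x), _, _]
      (iff (var 2) (and (or (var 1) (and (var 0) (var 4))) (or (neg (var 0)) (var 5))))
      (imp (var 4) (imp (var 0) (var 3)))
      (imp (neg (var 3)) (imp (neg (var 1)) (imp (var 0) (neg (var 2)))))
      hdef (joinLiteral_imp x)
  · exact Prov.rule₂ [var w, var x, var (ρ x), var (f x), _, _]
      (iff (var 2) (and (or (var 1) (and (var 0) (var 4))) (or (neg (var 0)) (var 5))))
      (imp (var 3) (imp (var 0) (var 5)))
      (imp (var 3) (imp (var 1) (imp (var 0) (var 2)))) hdef (imp_meetLiteral x)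

/-- If `l̄` is a path literal, then so are all other literals of `K` over `𝒮`, hence only the case
`k = l` remains. -/
theorem restricted_imp_imp_on_renameClause {k : Literal} (hK : K ∈ Q.matrix) (hb : K.card ≤ b)
    (hl : l ∈ K) (hk : k ∈ K) :
    Prov Γ (b + 3) (imp (k.rename f).toFormula
      (imp l.toFormula (imp (var w) (clauseFormula (renameClause ρ K))))) := by
  by_cases hkpath : Q.IsPathLit C u k ∨ k.var ∉ Q.pre.dependents u.var
  · exact (Prov.rule₂ [(k.rename f).toFormula, l.toFormula, var w, (k.rename ρ).toFormula, _]
      (imp (var 0) (imp (var 2) (var 3))) (imp (var 3) (var 4))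
      (imp (var 0) (imp (var 1) (imp (var 2) (var 4))))
      (h.restricted_imp_on_rename hkpath) (Prov.imp_renameClause hb hk)).le (by omega)
  by_cases hlpath : Q.IsPathLit C u l.neg
  · push Not at hkpath
    obtain rfl : k = l := by
      by_contra hkl
      exact hkpath.1 (hlpath.step hK (by rwa [Literal.neg_neg]) hk (by rwa [Literal.neg_neg])
        hkpath.2)
    exact (Prov.rule₂ [(k.rename f).toFormula, k.toFormula, var w, (k.rename ρ).toFormula, _]
      (imp (var 0) (imp (var 1) (imp (var 2) (var 3)))) (imp (var 3) (var 4))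
      (imp (var 0) (imp (var 1) (imp (var 2) (var 4))))
      (h.imp_restricted_imp_on_rename hkpath.2) (Prov.imp_renameClause hb hl)).le (by omega)
  · exact (Prov.rule₂ [(k.rename f).toFormula, l.toFormula, var w, (l.rename ρ).toFormula, _]
      (imp (var 1) (imp (var 2) (var 3))) (imp (var 3) (var 4))
      (imp (var 0) (imp (var 1) (imp (var 2) (var 4))))
      (h.imp_on_rename hlpath) (Prov.imp_renameClause hb hl)).le (by omega)

theorem imp_on_renameClause_of_outerClause_subset {D : Clause} {m : ℕ}
    (hs : Q.IsSwitch C u Γ m w) (hb : K.card ≤ b) (hD : Q.IsReachable C u D) (huD : u.neg ∈ D)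
    (hDK : Q.pre.outerClause u.var D ⊆ K) :
    Prov Γ (m + (b + 3) ^ 3) (imp (var w) (clauseFormula (renameClause ρ K))) := by
  have outer_imp : Prov Γ (b * (b + 1) + 1)
      (imp (clauseFormula (Q.pre.outerClause u.var D)) (clauseFormula (renameClause ρ K))) := by
    refine (Prov.clauseFormula_imp (n := b) fun l hl => ?_).le
      (by gcongr; exact (Finset.card_le_card hDK).trans hb)
    have hlS := DepPrefix.notMem_dependents_of_mem_outerClause hl
    simpa only [Literal.rename_eq_self (h.copy_eq _ hlS)] using
      Prov.imp_renameClause (Γ := Γ) (ρ := ρ) hb (hDK hl)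
  exact ((hs.outer D hD huD).imp_trans outer_imp).le (by ring_nf; omega)

theorem imp_on_renameClause_of_notMem (hK : K ∈ Q.matrix) (hb : K.card ≤ b) (huK : u.neg ∉ K)
    (huK' : u ∉ K) :
    Prov Γ ((b + 3) ^ 3) (imp (var w) (clauseFormula (renameClause ρ K))) := by
  have hres := h.restricted_mem K hK huK
  rw [Finset.erase_eq_of_notMem huK'] at hres
  have literal (l) (hl : l ∈ K) : Prov Γ (b * (b + 4) + 2)
      (imp l.toFormula (imp (var w) (clauseFormula (renameClause ρ K)))) :=
    ((Prov.renameClause_imp hb fun k hk =>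
      h.restricted_imp_imp_on_renameClause hK hb hl hk).mp (.hyp (n := 0) hres)).le
        (by ring_nf; omega)
  refine ((Prov.clauseFormula_imp literal).mp (.hyp (n := 0) (h.matrix_subset K hK))).le ?_
  calc K.card * (b * (b + 4) + 2 + 1) + 1 + 0 + 1 ≤ b * (b * (b + 4) + 2 + 1) + 1 + 0 + 1 := by
        gcongr
    _ ≤ (b + 3) ^ 3 := by ring_nf; omega

theorem imp_on_renameClause {m : ℕ} (hs : Q.IsSwitch C u Γ m w) (hu : u.var ∈ Q.pre.univ)
    (hK : K ∈ Q.matrix) (hb : K.card ≤ b) :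
    Prov Γ (m + (b + 3) ^ 3) (imp (var w) (clauseFormula (renameClause ρ K))) := by
  by_cases huK : u ∈ K
  · have pivot_imp := Prov.imp_renameClause (Γ := Γ) (ρ := ρ) hb huK
    rw [Literal.rename_eq_self (h.copy_eq _ (DepPrefix.notMem_dependents_of_mem_univ hu))]
      at pivot_imp
    exact (hs.pivot.imp_trans pivot_imp).le (by ring_nf; omega)
  by_cases huK' : u.neg ∈ K
  · by_cases hpath : ∃ l ∈ K, Q.IsPathLit C u l.neg
    · obtain ⟨l, hl, hpath⟩ := hpath
      exact h.imp_on_renameClause_of_outerClause_subset hs hb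
        (.inr ⟨hK, l.neg, hpath, by rwa [Literal.neg_neg]⟩) huK' DepPrefix.outerClause_subset
    · push Not at hpath
      have literal (l) (hl : l ∈ K) : Prov Γ (b + 2)
          (imp l.toFormula (imp (var w) (clauseFormula (renameClause ρ K)))) :=
        (Prov.rule₂ [l.toFormula, var w, (l.rename ρ).toFormula, _]
          (imp (var 0) (imp (var 1) (var 2))) (imp (var 2) (var 3))
          (imp (var 0) (imp (var 1) (var 3)))
          (h.imp_on_rename (hpath l hl)) (Prov.imp_renameClause hb hl)).le (by omega)
      refine ((Prov.clauseFormula_imp literal).mp (.hyp (n := 0) (h.matrix_subset K hK))).le ?_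
      calc K.card * (b + 2 + 1) + 1 + 0 + 1 ≤ b * (b + 2 + 1) + 1 + 0 + 1 := by gcongr
        _ ≤ m + (b + 3) ^ 3 := by ring_nf; omega
  · exact (h.imp_on_renameClause_of_notMem hK hb huK' huK).le (Nat.le_add_left _ _)

theorem imp_on_renameClause_pivotClause {m : ℕ} (hs : Q.IsSwitch C u Γ m w)
    (hu : u.var ∈ Q.pre.univ) (hC : insert u C ∈ Q.matrix) (hb : (insert u C).card ≤ b) :
    Prov Γ (m + (b + 3) ^ 3) (imp (var w) (clauseFormula (renameClause ρ C))) := by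
  have hCb : C.card ≤ b := (Finset.card_le_card (Finset.subset_insert u C)).trans hb
  by_cases huC : u ∈ C
  · rw [Finset.insert_eq_of_mem huC] at hC
    exact h.imp_on_renameClause hs hu hC hCb
  by_cases huC' : u.neg ∈ C
  · refine h.imp_on_renameClause_of_outerClause_subset hs hCb (.inl (Finset.mem_singleton_self _))
      (Finset.mem_insert_of_mem huC') fun l hl => ?_
    refine Finset.mem_of_mem_insert_of_ne (DepPrefix.outerClause_subset hl) ?_
    rintro rfl
    exact DepPrefix.var_ne_of_mem_outerClause hu hl rfl
  · have hres := h.restricted_mem _ hC (by simp [huC', Literal.neg_ne])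
    rw [Finset.erase_insert huC] at hres
    have literal (l) (hl : l ∈ C) : Prov Γ (b + 3)
        (imp (l.rename f).toFormula (imp (var w) (clauseFormula (renameClause ρ C)))) := by
      have hpath : Q.IsPathLit C u l ∨ l.var ∉ Q.pre.dependents u.var := by
        rw [or_iff_not_imp_right, not_not]
        exact .init (Finset.mem_singleton_self _) (Finset.mem_insert_of_mem hl)
      exact (Prov.rule₂ [(l.rename f).toFormula, var w, (l.rename ρ).toFormula, _]
        (imp (var 0) (imp (var 1) (var 2))) (imp (var 2) (var 3))
        (imp (var 0) (imp (var 1) (var 3)))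
        (h.restricted_imp_on_rename hpath) (Prov.imp_renameClause hCb hl)).le (by omega)
    exact ((Prov.renameClause_imp hCb literal).mp (.hyp (n := 0) hres)).le (by ring_nf; omega)

theorem imp_off_renameClause (hb : K.card ≤ b)
    (hK : Prov Γ n (imp (neg (var w)) (clauseFormula K))) :
    Prov Γ (n + (b + 3) ^ 2) (imp (neg (var w)) (clauseFormula (renameClause ρ K))) := by
  refine (hK.clause_cases (m := b + 2) fun l hl => ?_).le ?_
  · exact (Prov.rule₂ [l.toFormula, neg (var w), (l.rename ρ).toFormula, _]
      (imp (var 0) (imp (var 1) (var 2))) (imp (var 2) (var 3))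
      (imp (var 0) (imp (var 1) (var 3)))
      (h.imp_off_rename l) (Prov.imp_renameClause hb hl)).le (by omega)
  · calc n + K.card * (b + 2 + 1) + 2 ≤ n + b * (b + 2 + 1) + 2 := by gcongr
      _ ≤ n + (b + 3) ^ 2 := by ring_nf; omega

theorem prov_renameClause {m : ℕ} (hs : Q.IsSwitch C u Γ m w) (hu : u.var ∈ Q.pre.univ)
    (hC : insert u C ∈ Q.matrix) (hb : ∀ K ∈ Q.matrix, K.card ≤ b)
    (hK : K = C ∨ K ∈ Q.matrix) :
    Prov Γ (2 * (m + (b + 3) ^ 3)) (clauseFormula (renameClause ρ K)) := by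
  obtain ⟨on, off⟩ : Prov Γ (m + (b + 3) ^ 3) (imp (var w) (clauseFormula (renameClause ρ K))) ∧
      Prov Γ (m + 1 + (b + 3) ^ 2)
        (imp (neg (var w)) (clauseFormula (renameClause ρ K))) := by
    rcases hK with rfl | hK
    · have hKb := (Finset.card_le_card (Finset.subset_insert u K)).trans (hb _ hC)
      exact ⟨h.imp_on_renameClause_pivotClause hs hu hC (hb _ hC),
        h.imp_off_renameClause hKb (hs.clause.le (Nat.le_succ m))⟩
    · exact ⟨h.imp_on_renameClause hs hu hK (hb K hK), h.imp_off_renameClause (hb K hK)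
        ((Prov.hyp (n := m) (h.matrix_subset K hK)).imp_const)⟩
  exact (Prov.rule₂ [var w, _] (imp (var 0) (var 1)) (imp (neg (var 0)) (var 1)) (var 1)
    on off).le (by ring_nf; omega)

end IsCopy

end DQBF

end Copies

/-! ### Construction of the reduced copy -/

theorem conjFormula_singleton (l : Literal) : conjFormula {l} = and l.toFormula tru := by
  simp [conjFormula, bigAnd]

namespace DQBF

theorem card_matrix_le (Q : DQBF) : Q.matrix.card ≤ Q.size := by
  have : Q.matrix.card ≤ ∑ K ∈ Q.matrix, (1 + K.card) := by
    rw [Finset.card_eq_sum_ones]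
    exact Finset.sum_le_sum fun _ _ => Nat.le_add_right _ _
  unfold size
  omega

theorem card_le_of_mem_matrix {K : Clause} (hK : K ∈ Q.matrix) : K.card ≤ Q.size := by
  have := Finset.single_le_sum (f := fun K : Clause => 1 + K.card) (fun _ _ => Nat.zero_le _) hK
  unfold size
  omega

theorem card_dependents_le (Q : DQBF) (u : ℕ) : (Q.pre.dependents u).card ≤ Q.size := by
  have hle : Q.pre.exis.card ≤ ∑ x ∈ Q.pre.exis, (1 + (Q.pre.dep x).card) := by
    rw [Finset.card_eq_sum_ones]
    exact Finset.sum_le_sum fun _ _ => Nat.le_add_right _ _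
  have : (Q.pre.dependents u).card ≤ Q.pre.exis.card := Finset.card_filter_le _ _
  unfold size
  omega

end DQBF

theorem Literal.eq_or_eq_neg {k l : Literal} (h : k.var = l.var) : k = l ∨ k = l.neg := by
  obtain ⟨x, a⟩ := k
  obtain ⟨y, b⟩ := l
  cases a <;> cases b <;> simp_all [Literal.neg]

namespace DQBF

/-- The variable `f x` has the value that `x ∈ 𝒮` takes when `u` is false; hence it does not depend
on `u`. -/
structure IsRestriction (Q : DQBF) (u : Literal) (s : Stage) (f : ℕ → ℕ) : Prop where
  eq_self : ∀ x ∉ Q.pre.dependents u.var, f x = x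
  mem_varsWithin : ∀ x ∈ Q.pre.dependents u.var,
    f x ∈ s.pre.varsWithin ((Q.pre.dep x).erase u.var)
  imp_iff_mem : ∀ x ∈ Q.pre.dependents u.var,
    imp (conjFormula {u.neg}) (iff (var (f x)) (conjFormula {⟨x, true⟩})) ∈ s.lines

theorem IsRestriction.mono {u : Literal} {f : ℕ → ℕ} (h : Q.IsRestriction u s f) (hst : s ≤ t) :
    Q.IsRestriction u t f :=
  ⟨h.eq_self, fun x hx => DepPrefix.varsWithin_subset_of_le hst.1 (h.mem_varsWithin x hx),
    fun x hx => hst.2 (h.imp_iff_mem x hx)⟩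

end DQBF

namespace Attains

theorem matrix :
    Attains F Q Q.size s fun t => ∀ K ∈ Q.matrix, clauseFormula K ∈ t.lines :=
  (forall_finset fun _ hK => .axiom_clause hK).le (by simpa using Q.card_matrix_le)

theorem exists_restriction {u : Literal} (hs : Q.pre ≤ s.pre) (hu : u.var ∈ Q.pre.univ) :
    Attains F Q Q.size s fun t => ∃ f, Q.IsRestriction u t f := by
  refine ((exists_newVars id (I := Q.pre.dependents u.var)
    (D := fun x => (Q.pre.dep x).erase u.var)
    (A := fun x v => imp (conjFormula {u.neg}) (iff (var v) (conjFormula {⟨x, true⟩})))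
    fun x hx t hst => ext_conj ?_ ?_).map fun t _ ⟨f, _, hf₀, hf⟩ =>
      ⟨f, hf₀, fun x hx => (hf x hx).1.mem_varsWithin, fun x hx => (hf x hx).2⟩).le
    (by simpa using Q.card_dependents_le u.var)
  · simpa [Literal.neg, DepPrefix.univ_eq_of_le (hs.trans hst.1)] using hu
  · have hx' : x ∈ Q.pre.varsWithin (Q.pre.dep x) :=
      DepPrefix.mem_varsWithin_of_mem_exis (Finset.mem_filter.1 hx).1 subset_rfl
    have := DepPrefix.varsWithin_subset_of_le (hs.trans hst.1) hx'
    rw [Finset.image_singleton, Literal.neg]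
    simpa [Finset.insert_erase (Finset.mem_filter.1 hx).2] using this

end Attains

theorem Prov.or_restriction {K : Clause} {b : ℕ} {u : Literal} {f : ℕ → ℕ}
    (hf : Q.IsRestriction u s f) (hK : clauseFormula K ∈ s.lines) (hb : K.card ≤ b) :
    Prov {L | L ∈ s.lines} ((b + 2) ^ 2)
      (or u.toFormula (clauseFormula (renameClause f (K.erase u)))) := by
  set A := clauseFormula (renameClause f (K.erase u))
  have literal (l) (hl : l ∈ K) :
      Prov {L | L ∈ s.lines} (b + 2) (imp l.toFormula (or u.toFormula A)) := by
    by_cases hlu : l = u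
    · subst hlu
      exact (Prov.rule₀ [l.toFormula, A] (imp (var 0) (or (var 0) (var 1)))).le (by omega)
    have hA : Prov {L | L ∈ s.lines} b (imp (l.rename f).toFormula A) :=
      Prov.imp_renameClause (Finset.card_erase_le.trans hb) (Finset.mem_erase.2 ⟨hlu, hl⟩)
    by_cases hlS : l.var ∈ Q.pre.dependents u.var
    · have hdef := hf.imp_iff_mem _ hlS
      rw [conjFormula_singleton, conjFormula_singleton] at hdef
      obtain ⟨x, _ | _⟩ := l
      · exact (Prov.rule₃ [u.neg.toFormula, u.toFormula, var x, var (f x), A]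
          (imp (and (var 0) tru) (iff (var 3) (and (var 2) tru))) (iff (var 0) (neg (var 1)))
          (imp (neg (var 3)) (var 4)) (imp (neg (var 2)) (or (var 1) (var 4)))
          (.hyp (n := 0) hdef) (Prov.neg_literal_iff u) hA).le (by omega)
      · exact (Prov.rule₃ [u.neg.toFormula, u.toFormula, var x, var (f x), A]
          (imp (and (var 0) tru) (iff (var 3) (and (var 2) tru))) (iff (var 0) (neg (var 1)))
          (imp (var 3) (var 4)) (imp (var 2) (or (var 1) (var 4)))
          (.hyp (n := 0) hdef) (Prov.neg_literal_iff u) hA).le (by omega)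
    · rw [Literal.rename_eq_self (hf.eq_self _ hlS)] at hA
      exact (Prov.rule₁ [l.toFormula, u.toFormula, A] (imp (var 0) (var 2))
        (imp (var 0) (or (var 1) (var 2))) hA).le (by omega)
  refine ((Prov.clauseFormula_imp literal).mp (.hyp (n := 0) hK)).le ?_
  calc K.card * (b + 2 + 1) + 1 + 0 + 1 ≤ b * (b + 2 + 1) + 1 + 0 + 1 := by gcongr
    _ ≤ (b + 2) ^ 2 := by ring_nf; omega

namespace Simulates

open DepPrefix (varsWithin_subset_vars varsWithin_subset_of_le)

variable {N : ℕ} (hF : Simulates F N) {u : Literal} {f : ℕ → ℕ}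
include hF

theorem attains_restricted_clause {K : Clause} (hs : Q.pre ≤ s.pre) (hu : u.var ∈ Q.pre.univ)
    (hf : Q.IsRestriction u s f) (hK : K ∈ Q.matrix) (hKs : clauseFormula K ∈ s.lines)
    (huK : u.neg ∉ K) :
    Attains F Q (N * (Q.size + 2) ^ 2 + (1 + N * 1)) s
      (clauseFormula (renameClause f (K.erase u)) ∈ ·.lines) := by
  have hus : u.var ∈ s.pre.univ := (DepPrefix.univ_eq_of_le hs).symm ▸ hu
  have hvar (l) (hl : l ∈ K.erase u) : f l.var ∈ s.pre.varsWithin (s.pre.univ.erase u.var) := by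
    obtain ⟨hlu, hlK⟩ := Finset.mem_erase.1 hl
    rw [DepPrefix.univ_eq_of_le hs]
    by_cases hlS : l.var ∈ Q.pre.dependents u.var
    · exact DepPrefix.varsWithin_subset_of_subset (Finset.erase_subset_erase _
        (Q.pre.dep_subset _ (Finset.mem_filter.1 hlS).1)) (hf.mem_varsWithin _ hlS)
    rw [hf.eq_self _ hlS]
    refine varsWithin_subset_of_le hs ?_
    rcases Finset.mem_union.1 (Q.closed K hK l hlK) with hl | hl
    · refine DepPrefix.mem_varsWithin_of_mem_univ hl (Finset.mem_erase.2 ⟨fun hlu' => ?_, hl⟩)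
      exact (Literal.eq_or_eq_neg hlu').elim hlu fun h => huK (h ▸ hlK)
    · refine DepPrefix.mem_varsWithin_of_mem_exis hl
        (Finset.subset_erase.2 ⟨Q.pre.dep_subset _ hl, fun hdep => hlS ?_⟩)
      exact Finset.mem_filter.2 ⟨hl, hdep⟩
  have hvars : (clauseFormula (renameClause f (K.erase u))).vars ⊆
      s.pre.varsWithin (s.pre.univ.erase u.var) :=
    vars_clauseFormula_subset (Finset.forall_mem_image.2 hvar)
  refine (hF.attains_of_prov (Prov.or_restriction hf hKs (Q.card_le_of_mem_matrix hK)) ?_).bind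
    fun t hst ht => hF.attains_of_or_universal ht ?_ ?_
  · rw [Formula.vars, Literal.vars_toFormula]
    exact Finset.union_subset (Finset.singleton_subset_iff.2 (Finset.mem_union_left _ hus))
      (hvars.trans varsWithin_subset_vars)
  · rwa [DepPrefix.univ_eq_of_le hst.1]
  · rw [DepPrefix.univ_eq_of_le hst.1]
    exact hvars.trans (varsWithin_subset_of_le hst.1)

theorem exists_restricted_clauses (hs : Q.pre ≤ s.pre) (hu : u.var ∈ Q.pre.univ) :
    Attains F Q (2 * Q.size + Q.size * (N * (Q.size + 2) ^ 2 + (1 + N * 1))) s fun t =>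
      ∃ f, Q.IsRestriction u t f ∧ (∀ K ∈ Q.matrix, clauseFormula K ∈ t.lines) ∧
        ∀ K ∈ Q.matrix, u.neg ∉ K → clauseFormula (renameClause f (K.erase u)) ∈ t.lines := by
  rw [two_mul, add_assoc]
  refine Attains.matrix.bind fun t₁ h₁ hmatrix =>
    (Attains.exists_restriction (hs.trans h₁.1) hu).bind fun t₂ h₂ ⟨f, hf⟩ => ?_
  have restricted : Attains F Q (Q.size * (N * (Q.size + 2) ^ 2 + (1 + N * 1))) t₂ fun t =>
      ∀ K ∈ Q.matrix.filter (u.neg ∉ ·),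
        clauseFormula (renameClause f (K.erase u)) ∈ t.lines := by
    refine (Attains.forall_finset fun K hK => ?_).le
      (Nat.mul_le_mul_right _ ((Finset.card_filter_le _ _).trans Q.card_matrix_le))
    obtain ⟨hK, huK⟩ := Finset.mem_filter.1 hK
    exact hF.attains_restricted_clause ((hs.trans h₁.1).trans h₂.1) hu hf hK
      (h₂.2 (hmatrix K hK)) huK
  exact restricted.map fun t₃ h₃ hres => ⟨f, hf.mono h₃,
    fun K hK => h₃.2 (h₂.2 (hmatrix K hK)),
    fun K hK huK => hres K (Finset.mem_filter.2 ⟨hK, huK⟩)⟩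

end Simulates

theorem DQBF.IsSwitch.mono {C : Clause} {u : Literal} {m w : ℕ} (h : Q.IsSwitch C u Γ m w)
    (hΓ : Γ ⊆ Δ) : Q.IsSwitch C u Δ m w :=
  ⟨h.pivot.mono hΓ, fun D hD huD => (h.outer D hD huD).mono hΓ, h.clause.mono hΓ⟩

theorem Prov.imp_of_insert_neg {K : Clause} {l : Literal}
    (h : clauseFormula (insert l K) ∈ Γ) :
    Prov Γ ((K.card + 1) * (K.card + 2) + 3) (imp (neg (clauseFormula K)) l.toFormula) := by
  refine ((imp_const (.hyp (n := 0) h)).clause_cases (m := K.card + 1) fun k hk => ?_).le ?_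
  · rcases Finset.mem_insert.1 hk with rfl | hk
    · exact (rule₀ [k.toFormula, clauseFormula K] (imp (var 0) (imp (neg (var 1)) (var 0)))).le
        (by omega)
    · exact rule₁ [k.toFormula, clauseFormula K, l.toFormula] (imp (var 0) (var 1))
        (imp (var 0) (imp (neg (var 1)) (var 2))) (imp_clauseFormula hk)
  · have := Finset.card_insert_le l K
    nlinarith

theorem DQBF.isSwitch {φ χ : CNF} {C : Clause} {u : Literal} {b w : ℕ} {o : Clause → ℕ}
    (hχ : ∀ D, Q.IsReachable C u D → u.neg ∈ D → D ∈ χ)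
    (hw : iff (var w) (conjFormula (insert u (χ.image fun D => ⟨o D, true⟩))) ∈ Γ)
    (ho : ∀ D ∈ χ, iff (var (o D)) (clauseFormula (Q.pre.outerClause u.var D)) ∈ Γ)
    (hC : clauseFormula (insert u C) ∈ Γ) (hφ : ∀ K ∈ φ, clauseFormula K ∈ Γ)
    (hrefutes : ∀ D ∈ χ,
      UnitRefutes (φ ∪ negClause C ∪ negClause (Q.pre.outerClause u.var D)))
    (hCb : C.card ≤ b) (hφb : ∀ K ∈ φ, K.card ≤ b) (hφcard : φ.card ≤ b)
    (hχb : ∀ D ∈ χ, D.card ≤ b) (hχcard : χ.card ≤ b) :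
    Q.IsSwitch C u Γ (16 * (b + 1) ^ 4) w := by
  set Y : Finset Literal := insert u (χ.image fun D => ⟨o D, true⟩)
  have hYcard : Y.card ≤ b + 1 :=
    (Finset.card_insert_le _ _).trans (Nat.succ_le_succ (Finset.card_image_le.trans hχcard))
  have imp_conjunct (l) (hl : l ∈ Y) : Prov Γ (b + 2) (imp (var w) l.toFormula) :=
    (Prov.rule₂ [var w, conjFormula Y, l.toFormula] (iff (var 0) (var 1)) (imp (var 1) (var 2))
      (imp (var 0) (var 2)) (.hyp (n := 0) hw) (Prov.conjFormula_imp hl)).le (by omega)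
  have mem_conjuncts {D} (hD : D ∈ χ) : ⟨o D, true⟩ ∈ Y :=
    Finset.mem_insert_of_mem (Finset.mem_image_of_mem _ hD)
  have hle : b + 3 ≤ 16 * (b + 1) ^ 4 := by ring_nf; omega
  refine ⟨(imp_conjunct u (Finset.mem_insert_self _ _)).le (by omega), fun D hD huD => ?_, ?_⟩
  · have hDχ := hχ D hD huD
    exact (Prov.rule₂ [var w, var (o D), clauseFormula (Q.pre.outerClause u.var D)]
      (imp (var 0) (var 1)) (iff (var 1) (var 2)) (imp (var 0) (var 2))
      (imp_conjunct _ (mem_conjuncts hDχ)) (.hyp (n := 0) (ho D hDχ))).le hle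
  · have neg_imp (l) (hl : l ∈ Y) :
        Prov Γ (13 * (b + 1) ^ 3) (imp (neg (clauseFormula C)) l.toFormula) := by
      rcases Finset.mem_insert.1 hl with rfl | hl
      · refine (Prov.imp_of_insert_neg hC).le ?_
        calc (C.card + 1) * (C.card + 2) + 3 ≤ (b + 1) * (b + 2) + 3 := by gcongr
          _ ≤ 13 * (b + 1) ^ 3 := by ring_nf; omega
      · obtain ⟨D, hD, rfl⟩ := Finset.mem_image.1 hl
        have hO : (Q.pre.outerClause u.var D).card ≤ b :=
          (Finset.card_le_card DepPrefix.outerClause_subset).trans (hχb D hD)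
        exact (Prov.rule₂ [var (o D), clauseFormula C, _] (iff (var 0) (var 2))
          (imp (neg (var 1)) (var 2)) (imp (neg (var 1)) (var 0)) (.hyp (n := 0) (ho D hD))
          (Prov.neg_imp_of_unitRefutes (hrefutes D hD) hφ hφb hφcard hCb hO)).le
          (by ring_nf; omega)
    refine (Prov.rule₂ [var w, clauseFormula C, conjFormula Y] (iff (var 0) (var 2))
      (imp (neg (var 1)) (var 2)) (imp (neg (var 0)) (var 1)) (.hyp (n := 0) hw)
      (Prov.imp_conjFormula neg_imp)).le ?_
    calc 0 + (Y.card * (13 * (b + 1) ^ 3 + 1) + 1) + 1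
        ≤ 0 + ((b + 1) * (13 * (b + 1) ^ 3 + 1) + 1) + 1 := by gcongr
      _ ≤ 16 * (b + 1) ^ 4 := by ring_nf; omega

namespace Simulates

open DepPrefix (IsNewVar varsWithin_subset_of_le varsWithin_subset_of_subset)

variable {N : ℕ} (hF : Simulates F N) {φ : CNF} {C : Clause} {u : Literal} {w : ℕ} {f : ℕ → ℕ}
include hF

theorem exists_switch (hs : Q.pre ≤ s.pre) (hu : u.var ∈ Q.pre.univ)
    (hQ : Q.matrix = insert (insert u C) φ)
    (hrefutes : ∀ D, Q.IsReachable C u D → u.neg ∈ D →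
      UnitRefutes (φ ∪ negClause C ∪ negClause (Q.pre.outerClause u.var D)))
    (hmatrix : ∀ K ∈ Q.matrix, clauseFormula K ∈ s.lines) :
    Attains F Q ((Q.size + 1) * (1 + N * 2)) s fun t =>
      ∃ w ∈ t.pre.varsWithin (insert u.var (Q.pre.commonDeps u.var)),
        Q.IsSwitch C u {L | L ∈ t.lines} (16 * (Q.size + 1) ^ 4) w := by
  classical
  set χ : CNF := Q.matrix.filter fun D => Q.IsReachable C u D ∧ u.neg ∈ D
  have hC : insert u C ∈ Q.matrix := hQ ▸ Finset.mem_insert_self _ _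
  have hφ {K} (hK : K ∈ φ) : K ∈ Q.matrix := hQ ▸ Finset.mem_insert_of_mem hK
  have hχ (D) (hD : Q.IsReachable C u D) (huD : u.neg ∈ D) : D ∈ χ := by
    refine Finset.mem_filter.2 ⟨?_, hD, huD⟩
    rcases hD with hD | hD
    · rwa [Finset.mem_singleton.1 hD]
    · exact hD.1
  have hχcard : χ.card ≤ Q.size := (Finset.card_filter_le _ _).trans Q.card_matrix_le
  have outer : Attains F Q (Q.size * (1 + N * 2)) s fun t => ∃ o : Clause → ℕ, ∀ D ∈ χ,
      o D ∈ t.pre.varsWithin (Q.pre.commonDeps u.var) ∧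
      iff (var (o D)) (clauseFormula (Q.pre.outerClause u.var D)) ∈ t.lines :=
    ((Attains.exists_newVars (fun _ => 0) fun D _ t hst =>
      hF.exists_iff_clauseFormula fun l hl => varsWithin_subset_of_le (hs.trans hst.1)
        (DepPrefix.mem_varsWithin_of_mem_outerClause hl)).map fun t _ ⟨o, _, _, ho⟩ =>
      ⟨o, fun D hD => ⟨(ho D hD).1.mem_varsWithin, (ho D hD).2⟩⟩).le (by gcongr)
  rw [add_mul, one_mul]
  refine outer.bind fun t hst ⟨o, ho⟩ => (hF.exists_iff_conjFormula
    (Y := insert u (χ.image fun D => ⟨o D, true⟩))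
    (D := insert u.var (Q.pre.commonDeps u.var)) ?_).map fun t' htt' ⟨w, hw, hwt⟩ =>
      ⟨w, hw.mem_varsWithin, Q.isSwitch hχ hwt (fun D hD => htt'.2 (ho D hD).2)
        ((hst.trans htt').2 (hmatrix _ hC)) (fun K hK => (hst.trans htt').2 (hmatrix K (hφ hK)))
        (fun D hD => ?_) ?_ (fun K hK => Q.card_le_of_mem_matrix (hφ hK)) ?_
        (fun D hD => Q.card_le_of_mem_matrix (Finset.mem_filter.1 hD).1) hχcard⟩
  · simp only [Finset.mem_insert, Finset.mem_image, forall_eq_or_imp, forall_exists_index,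
      and_imp, forall_apply_eq_imp_iff₂]
    refine ⟨varsWithin_subset_of_le (hs.trans hst.1) (DepPrefix.mem_varsWithin_of_mem_univ hu
      (Finset.mem_insert_self _ _)), fun D hD => ?_⟩
    exact varsWithin_subset_of_subset (Finset.subset_insert _ _) (ho D hD).1
  · exact hrefutes D (Finset.mem_filter.1 hD).2.1 (Finset.mem_filter.1 hD).2.2
  · exact (Finset.card_le_card (Finset.subset_insert u C)).trans (Q.card_le_of_mem_matrix hC)
  · exact (Finset.card_le_card fun K hK => hφ hK).trans Q.card_matrix_le

theorem exists_switched_copies (hs : Q.pre ≤ s.pre)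
    (hw : w ∈ s.pre.varsWithin (insert u.var (Q.pre.commonDeps u.var)))
    (hf : Q.IsRestriction u s f) :
    Attains F Q (Q.size * (4 + N * 46)) s fun t => ∃ ρ : ℕ → ℕ,
      Set.InjOn ρ (Q.pre.dependents u.var) ∧ (∀ x ∉ Q.pre.dependents u.var, ρ x = x) ∧
      ∀ x ∈ Q.pre.dependents u.var, IsNewVar s.pre t.pre (ρ x) (Q.pre.dep x) ∧
        iff (var (ρ x)) (and (or (var x) (and (var w) (Q.joinLiteral C u w f x).toFormula))
          (or (neg (var w)) (Q.meetLiteral C u w f x).toFormula)) ∈ t.lines := by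
  refine (Attains.exists_newVars id (I := Q.pre.dependents u.var) (D := Q.pre.dep)
    (A := fun x v => iff (var v) (and (or (var x) (and (var w) (Q.joinLiteral C u w f x).toFormula))
      (or (neg (var w)) (Q.meetLiteral C u w f x).toFormula)))
    fun x hx t hst => ?_).le (Nat.mul_le_mul_right _ (Q.card_dependents_le u.var))
  obtain ⟨hxexis, hux⟩ := Finset.mem_filter.1 hx
  have hwx : w ∈ t.pre.varsWithin (Q.pre.dep x) := varsWithin_subset_of_le hst.1
    (varsWithin_subset_of_subset (Finset.insert_subset hux
      fun _ hv => (Finset.mem_filter.1 hv).2.2 x hx) hw)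
  have hfx : f x ∈ t.pre.varsWithin (Q.pre.dep x) := varsWithin_subset_of_le hst.1
    (varsWithin_subset_of_subset (Finset.erase_subset _ _) (hf.mem_varsWithin x hx))
  refine hF.exists_switched_copy hwx (varsWithin_subset_of_le (hs.trans hst.1)
    (DepPrefix.mem_varsWithin_of_mem_exis hxexis subset_rfl)) ?_ ?_
  · rw [DQBF.joinLiteral]
    split_ifs <;> assumption
  · rw [DQBF.meetLiteral]
    split_ifs <;> assumption

theorem attains_copied_clauses {ρ : ℕ → ℕ} {m : ℕ} (hs : Q.pre ≤ s.pre)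
    (hu : u.var ∈ Q.pre.univ) (hQ : Q.matrix = insert (insert u C) φ)
    (hw : Q.IsSwitch C u {L | L ∈ s.lines} m w) (hρ : Q.IsCopy C u {L | L ∈ s.lines} w f ρ)
    (hρs : ∀ x ∈ Q.pre.dependents u.var, ρ x ∈ s.pre.exis) :
    Attains F Q ((Q.size + 1) * (N * (2 * (m + (Q.size + 3) ^ 3)))) s fun t =>
      ∀ K ∈ insert C φ, clauseFormula (renameClause ρ K) ∈ t.lines := by
  have hC : insert u C ∈ Q.matrix := hQ ▸ Finset.mem_insert_self _ _
  have hφ {K} (hK : K ∈ φ) : K ∈ Q.matrix := hQ ▸ Finset.mem_insert_of_mem hK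
  have hcard : (insert C φ).card ≤ Q.size + 1 :=
    (Finset.card_insert_le _ _).trans (Nat.succ_le_succ
      ((Finset.card_le_card fun K hK => hφ hK).trans Q.card_matrix_le))
  refine (Attains.forall_finset fun K hK => ?_).le (Nat.mul_le_mul_right _ hcard)
  rw [Finset.mem_insert] at hK
  refine hF.attains_of_prov (hρ.prov_renameClause hw hu hC
    (fun _ => Q.card_le_of_mem_matrix) (hK.imp_right hφ)) ?_
  refine vars_clauseFormula_subset (Finset.forall_mem_image.2 fun l hl => ?_)
  by_cases hlS : l.var ∈ Q.pre.dependents u.var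
  · exact Finset.mem_union_right _ (hρs _ hlS)
  rw [hρ.copy_eq _ hlS]
  refine DepPrefix.vars_subset_of_le hs ?_
  rcases hK with rfl | hK
  · exact Q.closed _ hC l (Finset.mem_insert_of_mem hl)
  · exact Q.closed K (hφ hK) l hl

theorem exists_reduced_copy (hu : u.var ∈ Q.pre.univ) (hQ : Q.matrix = insert (insert u C) φ)
    (hrefutes : ∀ D, Q.IsReachable C u D → u.neg ∈ D →
      UnitRefutes (φ ∪ negClause C ∪ negClause (Q.pre.outerClause u.var D))) :
    Attains F Q (100 * (N + 1) * (Q.size + 3) ^ 5) ⟨Q.pre, []⟩ fun t => ∃ ρ : ℕ → ℕ,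
      (∀ x ∈ Q.pre.dependents u.var, IsNewVar Q.pre t.pre (ρ x) (Q.pre.dep x)) ∧
      Set.InjOn ρ (Q.pre.dependents u.var) ∧ (∀ x ∉ Q.pre.dependents u.var, ρ x = x) ∧
      ∀ K ∈ insert C φ, clauseFormula (renameClause ρ K) ∈ t.lines := by
  refine ((hF.exists_restricted_clauses le_rfl hu).bind fun t₁ h₁ ⟨f, hf, hmatrix, hres⟩ =>
    (hF.exists_switch h₁.1 hu hQ hrefutes hmatrix).bind fun t₂ h₂ ⟨w, hw, hswitch⟩ =>
    (hF.exists_switched_copies (h₁.trans h₂).1 hw (hf.mono h₂)).bind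
      fun t₃ h₃ ⟨ρ, hinj, hρ₀, hρ⟩ =>
    (hF.attains_copied_clauses (h₁.trans (h₂.trans h₃)).1 hu hQ (hswitch.mono h₃.2)
      (f := f) ⟨fun K hK => (h₂.trans h₃).2 (hmatrix K hK),
        fun K hK huK => (h₂.trans h₃).2 (hres K hK huK), hf.eq_self, hρ₀,
        fun x hx => (hρ x hx).2⟩ fun x hx => (hρ x hx).1.mem_exis).map
      fun t₄ h₄ hK => ⟨ρ, fun x hx => ((hρ x hx).1.mono (h₁.trans h₂).1).trans_le h₄.1,
        hinj, hρ₀, hK⟩).le ?_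
  ring_nf
  omega

end Simulates

end Stages

end DFrege

theorem mainTheorem7 (F : DFrege.FregeSystem) :
    ∃ p : Polynomial ℕ,
      ∀ (Q : DFrege.DQBF) (φ : DFrege.CNF) (C : DFrege.Clause) (u : DFrege.Literal),
        u.var ∈ Q.pre.univ →
        Q.matrix = insert (insert u C) φ →
        (∀ D : DFrege.Clause,
          DFrege.PathClause Q.matrix {insert u C} (Q.pre.dependents u.var) D → u.neg ∈ D →
          DFrege.UnitRefutes
            (φ ∪ DFrege.negClause C ∪ DFrege.negClause (Q.pre.outerClause u.var D))) →
        ∃ (n : ℕ) (s : DFrege.Stage) (ρ : ℕ → ℕ),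
          n ≤ p.eval Q.size ∧
          DFrege.Derives F Q n s ∧
          s.pre.univ = Q.pre.univ ∧
          Q.pre.exis ⊆ s.pre.exis ∧
          (∀ x ∈ Q.pre.exis, s.pre.dep x = Q.pre.dep x) ∧
          (∀ x ∈ Q.pre.dependents u.var,
            ρ x ∈ s.pre.exis ∧ ρ x ∉ Q.pre.vars ∧ s.pre.dep (ρ x) ⊆ Q.pre.dep x) ∧
          Set.InjOn ρ (Q.pre.dependents u.var) ∧
          (∀ x ∉ Q.pre.dependents u.var, ρ x = x) ∧
          ∀ K ∈ insert C φ,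
            DFrege.clauseFormula (DFrege.renameClause ρ K) ∈ s.lines := by
  obtain ⟨N, hF⟩ := DFrege.exists_simulates F
  refine ⟨100 * (Polynomial.C N + 1) * (Polynomial.X + 3) ^ 5, fun Q φ C u hu hQ hrefutes => ?_⟩
  obtain ⟨s, hs, ⟨n, hn, hder⟩, ρ, hρ, hinj, hρ₀, hcopy⟩ :=
    hF.exists_reduced_copy hu hQ hrefutes 0 ⟨Q.pre, []⟩ le_rfl ⟨0, le_rfl, .start⟩
  exact ⟨n, s, ρ, by simpa using hn, hder, DFrege.DepPrefix.univ_eq_of_le hs.1,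
    DFrege.DepPrefix.exis_subset_of_le hs.1, fun x hx => DFrege.DepPrefix.dep_eq_of_le hs.1 hx,
    fun x hx => ⟨(hρ x hx).mem_exis, (hρ x hx).notMem_vars, (hρ x hx).dep_subset⟩,
    hinj, hρ₀, hcopy⟩
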